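/- Write $\mathbb R^+=[0,\infty)$. A \emph{$d$-variate Lévy intensity} is a measure $\nu$ on $(\mathbb R^+)^d\times\mathbb R^+$ with $\nu(\{0\}\times\mathbb R^+)=0$ and $\int_{(\mathbb R^+)^d\times[0,T]}\min\{1,\|s\|\}\,\nu(ds,dx)<\infty$ for every $T\ge 0$. A process $Y=(Y_1,\dots,Y_d)$ with values in $(\mathbb R^+)^d$, indexed by $t\ge 0$, is a \emph{vector of subordinators with Lévy intensity $\nu$} if almost surely its paths are nondecreasing and right-continuous, it has independent increments (also independent of $Y(0)$), and for all $t\ge0$ and $\lambda\in(\mathbb R^+)^d$ $$\mathbb E\,e^{-\langle\lambda,Y(t)\rangle}=\exp\Big(-\int_{(\mathbb R^+)^d\times[0,t]}\big(1-e^{-\langle\lambda,s\rangle}\big)\,\nu(ds,dx)\Big);$$ for $d=1$ it is called a subordinator. Let $h$ be a probability density on $(\mathbb R^+)^d$ and $\nu^\star$ a univariate Lévy intensity. A \emph{compound vector of subordinators with score distribution $h$ and directing Lévy measure $\nu^\star$} is a vector of subordinators with Lévy intensity $$\nu(ds,dx)=\Big(\int z^{-d}\,h(s_1/z,\dots,s_d/z)\,\nu^\star(dz,dx)\Big)ds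 .$$ Let $Y^\star$ be a subordinator with Lévy intensity $\nu^\star$, and let $W_i,V_i$ ($i\ge1$) be $\mathbb R^+$-valued random variables. The series $\sum_i W_i\mathbf 1_{\{V_i\le t\}}$ is a \emph{series representation} of $Y^\star$ if the point process $\sum_{i:\,W_i\ne0}\delta_{(W_i,V_i)}$ is a Poisson random measure with intensity $\nu^\star$ and almost surely $Y^\star(t)=\sum_{i=1}^\infty W_i\mathbf 1_{\{V_i\le t\}}$ for all $t\ge0$. (Zero terms $W_i=0$ serve as padding when there are finitely many jumps.) A \emph{score sequence} for it is an i.i.d. sequence of vectors $(M_{1,i},\dots,M_{d,i})$, $i\ge 1$, with density $h$, independent of $(W_i,V_i)_{i\ge1}$. \textbf{Theorem.} Let $Y=(Y_1,\dots,Y_d)$ be a compound vector of subordinators with score distribution $h$ and directing Lévy measure $\nu^\star$, on a probability space $(\Omega,P)$. (1) There is an extension of the probability space (a probability space $(\Omega',P')$ with a measure-preserving map $\pi:\Omega'\to\Omega$, through which $Y$ is regarded as defined on $\Omega'$) carrying a subordinator $Y^\star$ with Lévy intensity $\nu^\star$, a series representation $\sum_i W_i\mathbf 1_{\{V_i\le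 t\}}$ of $Y^\star$ and a score sequence $(M_{1,i},\dots,M_{d,i})_{i\ge1}$ for it, such that almost surely, for all $(t_1,\dots,t_d)\in(\mathbb R^+)^d$, $$\big(Y_1(t_1),\dots,Y_d(t_d)\big)=\Big(\sum_{i=1}^\infty M_{1,i}W_i\mathbf 1_{\{V_i\le t_1\}},\dots,\sum_{i=1}^\infty M_{d,i}W_i\mathbf 1_{\{V_i\le t_d\}}\Big).$$ (2) Conversely, on any probability space, for every series representation $\sum_i W_i\mathbf 1_{\{V_i\le t\}}$ of a subordinator $Y^\star$ with Lévy intensity $\nu^\star$ and every score sequence for it, almost surely the series $\sum_i M_{j,i}W_i\mathbf 1_{\{V_i\le t\}}$ converge for all $t\ge0$ and $1\le j\le d$, and the process with these coordinates is a compound vector of subordinators with score distribution $h$ and directing Lévy measure $\nu^\star$. -/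

import Mathlib

open MeasureTheory ProbabilityTheory Set Filter Topology
open scoped NNReal ENNReal

universe u v

namespace CompoundSubordinator

/-- The measure `ν` on `(ℝ⁺)^d × ℝ⁺` (jump sizes times jump times) is a Lévy intensity: it does not
charge jumps of size zero and it integrates `min {1, ‖s‖}` over each bounded time interval.
All norms on `ℝ^d` give the same condition; the norm `∑ j, s j` is used. -/
structure IsLevyIntensity {d : ℕ} (ν : Measure ((Fin d → ℝ≥0) × ℝ≥0)) : Prop where
  null_zero : ν {p | p.1 = 0} = 0
  integrable : ∀ T : ℝ≥0,
    ∫⁻ p in {p | p.2 ≤ T}, ((min 1 (∑ j, p.1 j) : ℝ≥0) : ℝ≥0∞) ∂ν < ∞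

/-- `Y = (Y_1, …, Y_d)` is a `d`-variate vector of subordinators (positive jump Lévy processes, not
necessarily time-homogeneous) with Lévy intensity `ν`. The Laplace transform at time `0` says in
particular that `Y 0 = 0` almost surely, unless `ν` charges jumps at time `0`. -/
structure IsSubordinatorVector {Ω : Type*} [MeasurableSpace Ω] (P : Measure Ω) {d : ℕ}
    (ν : Measure ((Fin d → ℝ≥0) × ℝ≥0)) (Y : ℝ≥0 → Ω → Fin d → ℝ≥0) : Prop where
  levy : IsLevyIntensity ν
  measurable : ∀ t, Measurable (Y t)
  monotone : ∀ᵐ ω ∂P, Monotone fun t => Y t ω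
  right_continuous : ∀ᵐ ω ∂P, ∀ t, ContinuousWithinAt (fun s => Y s ω) (Ici t) t
  indep_increments : HasIndepIncrements (fun t ω (j : Fin d) => (Y t ω j : ℝ)) P
  indep_initial : IndepFun (Y 0) (fun ω (t : ℝ≥0) (j : Fin d) => (Y t ω j : ℝ) - Y 0 ω j) P
  laplace : ∀ (t : ℝ≥0) (l : Fin d → ℝ≥0),
    ∫ ω, Real.exp (-∑ j, (l j : ℝ) * Y t ω j) ∂P =
      Real.exp (-∫ p in {p | p.2 ≤ t}, (1 - Real.exp (-∑ j, (l j : ℝ) * p.1 j)) ∂ν)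

/-- A measure on `ℝ⁺ × ℝ⁺` regarded as a measure on `(ℝ⁺)^1 × ℝ⁺`. -/
noncomputable def oneVariate (ν : Measure (ℝ≥0 × ℝ≥0)) : Measure ((Fin 1 → ℝ≥0) × ℝ≥0) :=
  ν.map fun p => (fun _ => p.1, p.2)

/-- A univariate Lévy intensity: the case `d = 1`. -/
def IsUnivariateLevyIntensity (ν : Measure (ℝ≥0 × ℝ≥0)) : Prop :=
  IsLevyIntensity (oneVariate ν)

/-- A univariate subordinator with Lévy intensity `ν`: the case `d = 1`. -/
def IsSubordinator {Ω : Type*} [MeasurableSpace Ω] (P : Measure Ω)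
    (ν : Measure (ℝ≥0 × ℝ≥0)) (Y : ℝ≥0 → Ω → ℝ≥0) : Prop :=
  IsSubordinatorVector P (oneVariate ν) fun t ω _ => Y t ω

/-- Lebesgue measure on the orthant `(ℝ⁺)^d`. -/
noncomputable def orthantVolume (d : ℕ) : Measure (Fin d → ℝ≥0) :=
  (volume : Measure (Fin d → ℝ)).comap fun s j => (s j : ℝ)

/-- `h` is a probability density function on `(ℝ⁺)^d` with respect to Lebesgue measure. -/
structure IsScoreDensity {d : ℕ} (h : (Fin d → ℝ≥0) → ℝ≥0) : Prop where
  measurable : Measurable h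
  lintegral_eq_one : ∫⁻ s, (h s : ℝ≥0∞) ∂(orthantVolume d) = 1

/-- The law on `(ℝ⁺)^d` with density `h`. -/
noncomputable def scoreLaw {d : ℕ} (h : (Fin d → ℝ≥0) → ℝ≥0) : Measure (Fin d → ℝ≥0) :=
  (orthantVolume d).withDensity fun s => (h s : ℝ≥0∞)

/-- The measure `ν(ds, dx) = (∫ z^{-d} h(s_1 / z, …, s_d / z) ν⋆(dz, dx)) ds`, written as the image
under `((z, x), s) ↦ (s, x)` of the measure `z^{-d} h(s / z) ν⋆(dz, dx) ds`. -/
noncomputable def compoundIntensity {d : ℕ} (h : (Fin d → ℝ≥0) → ℝ≥0)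
    (νstar : Measure (ℝ≥0 × ℝ≥0)) : Measure ((Fin d → ℝ≥0) × ℝ≥0) :=
  ((νstar.prod (orthantVolume d)).withDensity fun q : (ℝ≥0 × ℝ≥0) × (Fin d → ℝ≥0) =>
    ((q.1.1⁻¹ ^ d * h (fun j => q.2 j / q.1.1) : ℝ≥0) : ℝ≥0∞)).map fun q => (q.2, q.1.2)

/-- `Y` is a `d`-variate compound vector of subordinators with score distribution `h` and directing
Lévy measure `νstar`. -/
structure IsCompoundVector {Ω : Type*} [MeasurableSpace Ω] (P : Measure Ω) {d : ℕ}
    (h : (Fin d → ℝ≥0) → ℝ≥0) (νstar : Measure (ℝ≥0 × ℝ≥0))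
    (Y : ℝ≥0 → Ω → Fin d → ℝ≥0) : Prop where
  score : IsScoreDensity h
  directing : IsUnivariateLevyIntensity νstar
  subordinator : IsSubordinatorVector P (compoundIntensity h νstar) Y

/-- The random measure `N` on `E` is a Poisson random measure with intensity `μ`. -/
structure IsPoissonRandomMeasure {Ω E : Type*} [MeasurableSpace Ω] [MeasurableSpace E]
    (P : Measure Ω) (μ : Measure E) (N : Ω → Measure E) : Prop where
  measurable : ∀ B, MeasurableSet B → Measurable fun ω => N ω B
  law : ∀ B, MeasurableSet B → μ B ≠ ∞ →
    P.map (fun ω => N ω B) =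
      (poissonMeasure (μ B).toNNReal).map (fun n : ℕ => (n : ℝ≥0∞))
  eq_top : ∀ B, MeasurableSet B → μ B = ∞ → ∀ᵐ ω ∂P, N ω B = ∞
  indep : ∀ (n : ℕ) (B : Fin n → Set E), (∀ k, MeasurableSet (B k)) →
    Pairwise (fun k l => Disjoint (B k) (B l)) → iIndepFun (fun k ω => N ω (B k)) P

/-- The point process `∑ i, δ_(W_i, V_i)` of the jumps `W_i` and their times `V_i`. Terms with
`W_i = 0` are not jumps and are left out: they pad the sequence when there are finitely many
jumps. -/
noncomputable def jumpMeasure {Ω : Type*} (W V : ℕ → Ω → ℝ≥0) (ω : Ω) : Measure (ℝ≥0 × ℝ≥0) :=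
  (Measure.sum fun i => Measure.dirac (W i ω, V i ω)).restrict {p | p.1 ≠ 0}

/-- `∑ i, W_i 1{V_i ≤ t}` is a series representation of the univariate subordinator `Ystar` with
Lévy intensity `νstar`: the `W_i` are the jumps of the underlying Poisson random measure with
intensity `νstar`, the `V_i` are their times, and almost surely the series is `Ystar t` for
all `t`. -/
structure IsSeriesRepresentation {Ω : Type*} [MeasurableSpace Ω] (P : Measure Ω)
    (νstar : Measure (ℝ≥0 × ℝ≥0)) (Ystar : ℝ≥0 → Ω → ℝ≥0) (W V : ℕ → Ω → ℝ≥0) : Prop where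
  subordinator : IsSubordinator P νstar Ystar
  measurable_weight : ∀ i, Measurable (W i)
  measurable_time : ∀ i, Measurable (V i)
  poisson : IsPoissonRandomMeasure P νstar (jumpMeasure W V)
  hasSum : ∀ᵐ ω ∂P, ∀ t : ℝ≥0,
    HasSum (fun i => W i ω * {x | x ≤ t}.indicator 1 (V i ω)) (Ystar t ω)

/-- The vectors `(M_{1,i}, …, M_{d,i})`, `i ∈ ℕ`, are i.i.d. with density `h`, and as a family they
are independent of the sequence `(W_i, V_i)`. -/
structure IsScoreSequence {Ω : Type*} [MeasurableSpace Ω] (P : Measure Ω) {d : ℕ}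
    (h : (Fin d → ℝ≥0) → ℝ≥0) (W V : ℕ → Ω → ℝ≥0) (M : ℕ → Ω → Fin d → ℝ≥0) : Prop where
  measurable : ∀ i, Measurable (M i)
  law : ∀ i, P.map (M i) = scoreLaw h
  iIndep : iIndepFun M P
  indep : IndepFun (fun ω i => M i ω) (fun ω i => (W i ω, V i ω)) P

end CompoundSubordinator

/-! The proof runs through Laplace functionals. A random measure `N` is Poisson with intensity `μ`
exactly when `E exp (-∫ F dN) = exp (-∫ (1 - e^{-F}) dμ)` for all measurable `F ≥ 0`
(`IsPoissonRandomMeasure.lintegral_expNeg`, `IsPoissonRandomMeasure.of_lintegral_expNeg`). Values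
lie in `[0, ∞]`, so divergent sums need no separate treatment.

Part (2) is the marking theorem. Averaging over the i.i.d. scores replaces `e^{-F}` by its mean
under `scoreLaw h`, so the points `((W_i, V_i), M_i)` have the Laplace functional of a Poisson
process with intensity `ν⋆ ⊗ scoreLaw h` (`IsMarkedPoisson.lintegral_expNeg`). The image of this
product under `((z, x), m) ↦ (z m, x)` is the compound intensity, by the substitution `s = z m`
(`compoundIntensity_eq_markedIntensity`). Sums of jumps over disjoint time sets are therefore
independent, almost surely finite over bounded times, and have the required Laplace transforms
(`IsMarkedPoisson.isSubordinatorVector`).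

Part (1) is a transfer argument. A marked Poisson process is built on a standard Borel space
(`exists_isMarkedPoisson`); its series `Y₂` is a vector of subordinators with the same intensity as
`Y`. The intensity determines the law along any sequence of times
(`IsSubordinatorVector.map_seq_eq`). Sampling the marked process from its conditional law, given
that `Y₂` equals the observed `Y` on a dense sequence of times, extends `Ω` so that `Y` and `Y₂`
agree there (`exists_extension`). Right-continuity gives agreement at all times at once, hence also
at different times `t_j` in different coordinates. -/

namespace CompoundSubordinator

/-! ### The exponential `e^{-x}` on `[0, ∞]`. -/

section ExpNeg

/-- The function `exp (-x)` for `x ∈ [0, ∞]`. -/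
noncomputable def expNeg (x : ℝ≥0∞) : ℝ≥0∞ := EReal.exp (-(x : EReal))

@[simp] lemma expNeg_zero : expNeg 0 = 1 := by simp [expNeg]

@[simp] lemma expNeg_top : expNeg ∞ = 0 := by simp [expNeg]

lemma expNeg_coe (x : ℝ≥0) : expNeg x = ENNReal.ofReal (Real.exp (-x)) := by
  rw [expNeg, ← EReal.exp_coe]; rfl

lemma expNeg_eq_ofReal {x : ℝ≥0∞} (hx : x ≠ ∞) :
    expNeg x = ENNReal.ofReal (Real.exp (-x.toReal)) := by
  lift x to ℝ≥0 using hx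
  exact expNeg_coe x

lemma expNeg_add (x y : ℝ≥0∞) : expNeg (x + y) = expNeg x * expNeg y := by
  rw [expNeg, EReal.coe_ennreal_add, EReal.neg_add (by simp) (by simp), sub_eq_add_neg,
    EReal.exp_add]
  rfl

lemma expNeg_le_one (x : ℝ≥0∞) : expNeg x ≤ 1 := by
  simp [expNeg, EReal.coe_ennreal_nonneg x]

lemma expNeg_antitone : Antitone expNeg := fun x y h => by simpa [expNeg] using h

lemma expNeg_injective : Function.Injective expNeg := fun x y h => by
  simpa [expNeg] using EReal.exp_strictMono.injective h

lemma continuous_expNeg : Continuous expNeg :=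
  ENNReal.continuous_exp.comp (continuous_neg.comp continuous_coe_ennreal_ereal)

@[fun_prop] lemma measurable_expNeg : Measurable expNeg := continuous_expNeg.measurable

lemma expNeg_sum {ι : Type*} (s : Finset ι) (f : ι → ℝ≥0∞) :
    expNeg (∑ i ∈ s, f i) = ∏ i ∈ s, expNeg (f i) := by
  classical
  induction s using Finset.induction_on with
  | empty => simp
  | insert a s ha ih => rw [Finset.sum_insert ha, Finset.prod_insert ha, expNeg_add, ih]

lemma expNeg_nat_mul (n : ℕ) (x : ℝ≥0∞) : expNeg (n * x) = expNeg x ^ n := by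
  have := expNeg_sum (Finset.range n) fun _ => x
  simpa using this

/-- Continuity of `expNeg` at `∞` covers divergent series as well. -/
lemma tendsto_prod_expNeg (f : ℕ → ℝ≥0∞) :
    Tendsto (fun n => ∏ i ∈ Finset.range n, expNeg (f i)) atTop (𝓝 (expNeg (∑' i, f i))) := by
  simp_rw [← expNeg_sum]
  exact (continuous_expNeg.tendsto _).comp (ENNReal.tendsto_nat_tsum f)

lemma one_sub_expNeg_le (x : ℝ≥0∞) : 1 - expNeg x ≤ min 1 x := by
  refine le_min tsub_le_self ?_
  rcases eq_or_ne x ∞ with rfl | hx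
  · simp
  rw [expNeg_eq_ofReal hx, tsub_le_iff_right]
  nth_rw 1 [← ENNReal.ofReal_toReal hx]
  rw [← ENNReal.ofReal_add ENNReal.toReal_nonneg (Real.exp_nonneg _), ← ENNReal.ofReal_one]
  refine ENNReal.ofReal_le_ofReal ?_
  linarith [Real.add_one_le_exp (-x.toReal)]

/-- The function `-log a` for `a ∈ [0, 1]`. -/
noncomputable def negLog (a : ℝ≥0∞) : ℝ≥0∞ := (ENNReal.log a⁻¹).toENNReal

@[fun_prop] lemma measurable_negLog : Measurable negLog := by
  unfold negLog
  fun_prop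

lemma expNeg_negLog {a : ℝ≥0∞} (ha : a ≤ 1) : expNeg (negLog a) = a := by
  have h : 0 ≤ ENNReal.log a⁻¹ := by
    rw [ENNReal.zero_le_log_iff]
    simpa using ha
  rw [expNeg, negLog, EReal.coe_toENNReal h, EReal.exp_neg, ENNReal.exp_log, inv_inv]

end ExpNeg

/-! ### Laplace transforms determine finite measures and detect independence. -/

section Uniqueness

/-- Finite measures are determined by the integrals of a separating family of continuous functions
with values in `[0, 1]` that is closed under multiplication. -/
theorem ext_of_lintegral_mul_closed {E Λ : Type*} [TopologicalSpace E] [PolishSpace E]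
    [MeasurableSpace E] [BorelSpace E] {μ μ' : Measure E} [IsFiniteMeasure μ] [IsFiniteMeasure μ']
    (φ : Λ → E → ℝ≥0∞) (hcont : ∀ a, Continuous (φ a)) (hle : ∀ a x, φ a x ≤ 1)
    (hone : ∃ a, φ a = 1) (hmul : ∀ a b, ∃ c, φ c = φ a * φ b)
    (hsep : ∀ x y, (∀ a, φ a x = φ a y) → x = y)
    (h : ∀ a, ∫⁻ x, φ a x ∂μ = ∫⁻ x, φ a x ∂μ') : μ = μ' := by
  have hfin : ∀ a x, φ a x ≠ ∞ := fun a x => ((hle a x).trans_lt (by simp)).ne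
  let g : Λ → BoundedContinuousFunction E ℝ := fun a =>
    BoundedContinuousFunction.ofNormedAddCommGroup (fun x => (φ a x).toReal)
      (ENNReal.continuousOn_toReal.comp_continuous (hcont a) (hfin a)) 1 (fun x => by
        rw [Real.norm_of_nonneg ENNReal.toReal_nonneg]
        exact ENNReal.toReal_le_of_le_ofReal zero_le_one (by simpa using hle a x))
  have hg : ∀ a x, g a x = (φ a x).toReal := fun a x => rfl
  let S : Submonoid (BoundedContinuousFunction E ℝ) :=
    { carrier := Set.range g
      one_mem' := by
        obtain ⟨a, ha⟩ := hone
        refine ⟨a, ?_⟩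
        ext x
        simp [hg, ha]
      mul_mem' := by
        rintro _ _ ⟨a, rfl⟩ ⟨b, rfl⟩
        obtain ⟨c, hc⟩ := hmul a b
        refine ⟨c, ?_⟩
        ext x
        simp [hg, hc] }
  let A : StarSubalgebra ℝ (BoundedContinuousFunction E ℝ) :=
    { Algebra.adjoin ℝ (S : Set (BoundedContinuousFunction E ℝ)) with
      star_mem' := by
        intro a ha
        have : star a = a := by ext x; simp
        rwa [this] }
  -- The range of `g` is closed under products, so the algebra it generates is its linear span, and
  -- by linearity only the `g a` have to be tested.
  have hA : ∀ f, f ∈ A ↔ f ∈ Submodule.span ℝ (S : Set (BoundedContinuousFunction E ℝ)) := by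
    intro f
    have : f ∈ A ↔ f ∈ Subalgebra.toSubmodule
      (Algebra.adjoin ℝ (S : Set (BoundedContinuousFunction E ℝ))) := Iff.rfl
    rw [this, Algebra.adjoin_eq_span, Submonoid.closure_eq]
  refine ext_of_forall_mem_subalgebra_integral_eq_of_polish (𝕜 := ℝ) (A := A) ?_ ?_
  · intro x y hxy
    by_contra hne
    refine hxy (hsep x y fun a => ?_)
    by_contra hd
    apply hne
    refine ⟨g a, ⟨BoundedContinuousFunction.toContinuousMapStarₐ ℝ (g a),
      ⟨g a, (hA _).2 (Submodule.subset_span ⟨a, rfl⟩), rfl⟩, rfl⟩, ?_⟩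
    rw [hg, hg]
    exact fun e => hd ((ENNReal.toReal_eq_toReal_iff' (hfin a x) (hfin a y)).1 e)
  · intro f hf
    rw [hA] at hf
    induction hf using Submodule.span_induction with
    | mem f hf =>
      obtain ⟨a, rfl⟩ := hf
      simp_rw [hg]
      rw [integral_toReal (hcont a).measurable.aemeasurable (.of_forall fun x => (hfin a x).lt_top),
        integral_toReal (hcont a).measurable.aemeasurable (.of_forall fun x => (hfin a x).lt_top),
        h]
    | zero => simp
    | add f₁ f₂ _ _ h₁ h₂ =>
      simp only [BoundedContinuousFunction.coe_add, Pi.add_apply]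
      rw [integral_add (f₁.integrable μ) (f₂.integrable μ),
        integral_add (f₁.integrable μ') (f₂.integrable μ'), h₁, h₂]
    | smul c f _ h => simp only [BoundedContinuousFunction.coe_smul, integral_const_mul, smul_eq_mul, h]

/-- A finite measure on `[0, ∞]` is determined by its Laplace transform. -/
theorem ext_of_lintegral_expNeg_mul {μ μ' : Measure ℝ≥0∞} [IsFiniteMeasure μ] [IsFiniteMeasure μ']
    (h : ∀ θ : ℝ≥0, ∫⁻ x, expNeg (θ * x) ∂μ = ∫⁻ x, expNeg (θ * x) ∂μ') : μ = μ' := by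
  refine ext_of_lintegral_mul_closed (fun (θ : ℝ≥0) x => expNeg (θ * x)) (fun θ => ?_)
    (fun _ _ => expNeg_le_one _) ⟨0, by ext; simp⟩ (fun a b => ⟨a + b, ?_⟩) (fun x y hxy => ?_) h
  · exact continuous_expNeg.comp (ENNReal.continuous_const_mul ENNReal.coe_ne_top)
  · ext x
    simp only [Pi.mul_apply, ENNReal.coe_add, add_mul, expNeg_add]
  · simpa using expNeg_injective (hxy 1)

variable {ι κ : Type*} [Fintype ι] [Fintype κ]

/-- A finite measure on `[0, ∞]^(κ × ι)` is determined by its Laplace transform. -/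
theorem ext_of_lintegral_expNeg₂ {μ μ' : Measure (κ → ι → ℝ≥0∞)} [IsFiniteMeasure μ]
    [IsFiniteMeasure μ']
    (h : ∀ θ : κ → ι → ℝ≥0, ∫⁻ x, expNeg (∑ k, ∑ i, θ k i * x k i) ∂μ =
      ∫⁻ x, expNeg (∑ k, ∑ i, θ k i * x k i) ∂μ') : μ = μ' := by
  classical
  refine ext_of_lintegral_mul_closed
    (fun (θ : κ → ι → ℝ≥0) x => expNeg (∑ k, ∑ i, θ k i * x k i)) (fun θ => ?_)
    (fun _ _ => expNeg_le_one _) ⟨0, by ext; simp⟩ (fun a b => ⟨a + b, ?_⟩) (fun x y hxy => ?_) h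
  · refine continuous_expNeg.comp (continuous_finsetSum _ fun k _ => continuous_finsetSum _
      fun i _ => ?_)
    exact (ENNReal.continuous_const_mul ENNReal.coe_ne_top).comp (by fun_prop)
  · ext x
    simp only [Pi.add_apply, Pi.mul_apply, ENNReal.coe_add, add_mul, Finset.sum_add_distrib,
      expNeg_add]
  · ext k i
    -- The unit test vector at `(k, i)` isolates one coordinate.
    have := expNeg_injective (hxy (Pi.single k (Pi.single i 1)))
    rw [Finset.sum_eq_single k, Finset.sum_eq_single i, Finset.sum_eq_single k,
      Finset.sum_eq_single i] at this
    · simpa using this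
    all_goals simp +contextual [Pi.single_apply]

/-- A finite measure on `(ℝ⁺)^ι` is determined by its Laplace transform. -/
theorem ext_of_lintegral_expNeg {μ μ' : Measure (ι → ℝ≥0)} [IsFiniteMeasure μ] [IsFiniteMeasure μ']
    (h : ∀ θ : ι → ℝ≥0, ∫⁻ x, expNeg ((∑ i, θ i * x i : ℝ≥0) : ℝ≥0∞) ∂μ =
      ∫⁻ x, expNeg ((∑ i, θ i * x i : ℝ≥0) : ℝ≥0∞) ∂μ') : μ = μ' := by
  classical
  refine ext_of_lintegral_mul_closed
    (fun (θ : ι → ℝ≥0) x => expNeg ((∑ i, θ i * x i : ℝ≥0) : ℝ≥0∞)) (fun θ => ?_)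
    (fun _ _ => expNeg_le_one _) ⟨0, by ext; simp⟩ (fun a b => ⟨a + b, ?_⟩) (fun x y hxy => ?_) h
  · exact continuous_expNeg.comp (ENNReal.continuous_coe.comp (by fun_prop))
  · ext x
    simp only [Pi.add_apply, Pi.mul_apply, ENNReal.coe_add, add_mul, Finset.sum_add_distrib,
      expNeg_add]
  · ext i
    have := ENNReal.coe_injective (expNeg_injective (hxy (Pi.single i 1)))
    rw [Finset.sum_eq_single i, Finset.sum_eq_single i] at this
    · simpa using this
    all_goals simp +contextual

/-- Random vectors are independent if their joint Laplace transform factorizes. -/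
theorem iIndepFun_of_lintegral_expNeg {Ω : Type*} [MeasurableSpace Ω] {P : Measure Ω}
    [IsProbabilityMeasure P] {X : κ → Ω → ι → ℝ≥0∞} (hX : ∀ k, Measurable (X k))
    (h : ∀ θ : κ → ι → ℝ≥0, ∫⁻ ω, expNeg (∑ k, ∑ i, θ k i * X k ω i) ∂P =
      ∏ k, ∫⁻ ω, expNeg (∑ i, θ k i * X k ω i) ∂P) : iIndepFun X P := by
  have hm : ∀ k, IsProbabilityMeasure (P.map (X k)) := fun k =>
    Measure.isProbabilityMeasure_map (hX k).aemeasurable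
  rw [iIndepFun_iff_map_fun_eq_pi_map fun k => (hX k).aemeasurable]
  have := Measure.isProbabilityMeasure_map (μ := P) (measurable_pi_lambda _ hX).aemeasurable
  refine ext_of_lintegral_expNeg₂ fun θ => ?_
  rw [lintegral_map (by fun_prop) (measurable_pi_lambda _ hX), h]
  simp_rw [expNeg_sum Finset.univ]
  have hmeas : ∀ k, Measurable fun x : ι → ℝ≥0∞ => ∏ i, expNeg (θ k i * x i) := fun k => by
    fun_prop
  rw [lintegral_prod_eq_prod_lintegral_of_indepFun (μ := Measure.pi fun k => P.map (X k))
    Finset.univ (fun k (x : κ → ι → ℝ≥0∞) => ∏ i, expNeg (θ k i * x k i))]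
  · refine Finset.prod_congr rfl fun k _ => ?_
    have e := (measurePreserving_eval (fun k => P.map (X k)) k).lintegral_comp
      (f := fun x => ∏ i, expNeg (θ k i * x i)) (hmeas k)
    simp only [Function.eval] at e
    rw [e, lintegral_map (hmeas k) (hX k)]
  · exact iIndepFun_pi (μ := fun k => P.map (X k))
      (X := fun k x => ∏ i, expNeg (θ k i * x i)) (fun k => (hmeas k).aemeasurable)
  · fun_prop

end Uniqueness

/-! ### The generating function of the Poisson law. -/

section Poisson

lemma lintegral_pow_poissonMeasure (r : ℝ≥0) {a : ℝ≥0∞} (ha : a ≤ 1) :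
    ∫⁻ n, a ^ n ∂(poissonMeasure r) = expNeg (r * (1 - a)) := by
  have hat : a ≠ ∞ := (ha.trans_lt (by simp)).ne
  lift a to ℝ≥0 using hat
  have ha' : (a : ℝ) ≤ 1 := by exact_mod_cast ha
  rw [poissonMeasure, lintegral_sum_measure]
  simp only [lintegral_smul_measure, lintegral_dirac, smul_eq_mul]
  have e : ∀ n : ℕ, ENNReal.ofReal (Real.exp (-r) * r ^ n / n.factorial) * (a : ℝ≥0∞) ^ n =
      ENNReal.ofReal (Real.exp (-r) * ((r * a : ℝ) ^ n / n.factorial)) := by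
    intro n
    rw [← ENNReal.ofReal_coe_nnreal, ← ENNReal.ofReal_pow a.coe_nonneg, ← ENNReal.ofReal_mul (by positivity)]
    congr 1
    rw [mul_pow]
    ring
  simp_rw [e]
  have hs := (NormedSpace.expSeries_div_hasSum_exp (r * a : ℝ)).mul_left (Real.exp (-r))
  rw [← ENNReal.ofReal_tsum_of_nonneg (fun n => by positivity) hs.summable, hs.tsum_eq,
    ← Real.exp_eq_exp_ℝ, ← Real.exp_add, expNeg_eq_ofReal (ENNReal.mul_ne_top (by simp) (by simp))]
  congr 2
  rw [ENNReal.toReal_mul, ENNReal.toReal_sub_of_le ha (by simp)]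
  simp
  ring

end Poisson

/-! ### Poisson random measures are characterized by their Laplace functional. -/

section PoissonRandomMeasure

variable {Ω E : Type*} [MeasurableSpace Ω] [MeasurableSpace E] {P : Measure Ω}
  {μ : Measure E} {N : Ω → Measure E}

lemma IsPoissonRandomMeasure.measurable_measure (hN : IsPoissonRandomMeasure P μ N) :
    Measurable N :=
  Measure.measurable_of_measurable_coe N fun B hB => hN.measurable B hB

/-- For finite `μ B` this is the Poisson generating function at `e^{-c}`. For infinite `μ B` and `c
≠ 0` both sides vanish, as `N B = ∞` almost surely. -/
lemma IsPoissonRandomMeasure.lintegral_expNeg_const_mul [IsProbabilityMeasure P]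
    (hN : IsPoissonRandomMeasure P μ N) {B : Set E} (hB : MeasurableSet B) (c : ℝ≥0∞) :
    ∫⁻ ω, expNeg (c * N ω B) ∂P = expNeg (μ B * (1 - expNeg c)) := by
  by_cases hμ : μ B = ∞
  · rcases eq_or_ne c 0 with rfl | hc
    · simp
    · have h1 : 1 - expNeg c ≠ 0 := by
        intro h
        have h2 : expNeg c = expNeg 0 := by
          rw [expNeg_zero]
          exact le_antisymm (expNeg_le_one c) (tsub_eq_zero_iff_le.1 h)
        exact hc (expNeg_injective h2)
      rw [hμ, ENNReal.top_mul h1, expNeg_top, lintegral_eq_zero_iff'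
        (by have := hN.measurable B hB; fun_prop)]
      filter_upwards [hN.eq_top B hB hμ] with ω hω
      simp [hω, ENNReal.mul_top hc]
  · have h := hN.law B hB hμ
    have e : ∫⁻ ω, expNeg (c * N ω B) ∂P = ∫⁻ x, expNeg (c * x) ∂P.map (fun ω => N ω B) := by
      rw [lintegral_map (by fun_prop) (hN.measurable B hB)]
    rw [e, h, lintegral_map (by fun_prop) (by fun_prop)]
    simp_rw [mul_comm c, expNeg_nat_mul]
    rw [lintegral_pow_poissonMeasure _ (expNeg_le_one c), ENNReal.coe_toNNReal hμ]

/-- The level sets of `f` are disjoint, so their counts are independent and the Laplace functional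
is a product over the values of `f`. -/
lemma IsPoissonRandomMeasure.lintegral_expNeg_simpleFunc [IsProbabilityMeasure P]
    (hN : IsPoissonRandomMeasure P μ N) (f : SimpleFunc E ℝ≥0∞) :
    ∫⁻ ω, expNeg (∫⁻ x, f x ∂N ω) ∂P = expNeg (∫⁻ x, (1 - expNeg (f x)) ∂μ) := by
  have hind : iIndepFun (fun (c : f.range) ω => N ω (f ⁻¹' {c.1})) P := by
    have h := hN.indep f.range.card (fun k => f ⁻¹' {(f.range.equivFin.symm k).1})
      (fun k => f.measurableSet_preimage _) (fun k l hkl => ?_)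
    · have := h.precomp f.range.equivFin.injective
      simpa using this
    · refine Disjoint.preimage f (disjoint_singleton.2 fun h => hkl ?_)
      exact f.range.equivFin.symm.injective (Subtype.ext h)
  have hR : ∫⁻ x, (1 - expNeg (f x)) ∂μ =
      ∑ c ∈ f.range, μ (f ⁻¹' {c}) * (1 - expNeg c) := by
    have := (f.map fun y => 1 - expNeg y).lintegral_eq_lintegral μ
    rw [SimpleFunc.map_lintegral] at this
    simp only [SimpleFunc.coe_map, Function.comp_apply] at this
    rw [this]
    exact Finset.sum_congr rfl fun c _ => mul_comm _ _
  simp_rw [f.lintegral_eq_lintegral, SimpleFunc.lintegral]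
  rw [hR]
  simp_rw [expNeg_sum]
  simp_rw [← Finset.prod_coe_sort f.range]
  rw [lintegral_prod_eq_prod_lintegral_of_indepFun Finset.univ
    (fun (c : f.range) ω => expNeg (c * N ω (f ⁻¹' {c.1})))]
  · exact Finset.prod_congr rfl fun c _ =>
      hN.lintegral_expNeg_const_mul (f.measurableSet_preimage _) c
  · exact hind.comp (fun c y => expNeg (c * y)) (fun c => by fun_prop)
  · intro c
    have := hN.measurable _ (f.measurableSet_preimage {c.1})
    fun_prop

/-- The Laplace functional of a Poisson random measure. -/
theorem IsPoissonRandomMeasure.lintegral_expNeg [IsProbabilityMeasure P]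
    (hN : IsPoissonRandomMeasure P μ N) {F : E → ℝ≥0∞} (hF : Measurable F) :
    ∫⁻ ω, expNeg (∫⁻ x, F x ∂N ω) ∂P = expNeg (∫⁻ x, (1 - expNeg (F x)) ∂μ) := by
  -- Simple functions increase to `F`, and continuity of `expNeg` on all of `[0, ∞]` lets both sides
  -- pass to the limit even when the integrals diverge.
  let f := SimpleFunc.eapprox F
  have hmono : ∀ x, Monotone fun n => f n x := fun x m n h => SimpleFunc.monotone_eapprox F h x
  have hlim : ∀ x, Tendsto (fun n => f n x) atTop (𝓝 (F x)) := fun x => by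
    have := tendsto_atTop_iSup (hmono x)
    rwa [SimpleFunc.iSup_eapprox_apply hF] at this
  have h1 : Tendsto (fun n => ∫⁻ ω, expNeg (∫⁻ x, f n x ∂N ω) ∂P) atTop
      (𝓝 (∫⁻ ω, expNeg (∫⁻ x, F x ∂N ω) ∂P)) := by
    refine tendsto_lintegral_of_dominated_convergence (fun _ => 1) (fun n => ?_)
      (fun n => .of_forall fun ω => expNeg_le_one _) (by simp) (.of_forall fun ω => ?_)
    · exact measurable_expNeg.comp
        ((Measure.measurable_lintegral (f n).measurable).comp hN.measurable_measure)
    · refine (continuous_expNeg.tendsto _).comp ?_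
      exact lintegral_tendsto_of_tendsto_of_monotone (fun n => (f n).measurable.aemeasurable)
        (.of_forall hmono) (.of_forall hlim)
  have h2 : Tendsto (fun n => expNeg (∫⁻ x, (1 - expNeg (f n x)) ∂μ)) atTop
      (𝓝 (expNeg (∫⁻ x, (1 - expNeg (F x)) ∂μ))) := by
    refine (continuous_expNeg.tendsto _).comp ?_
    refine lintegral_tendsto_of_tendsto_of_monotone
      (fun n => by have := (f n).measurable; fun_prop)
      (.of_forall fun x m n h => tsub_le_tsub_left (expNeg_antitone (hmono x h)) 1)
      (.of_forall fun x => ?_)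
    exact ENNReal.Tendsto.sub tendsto_const_nhds ((continuous_expNeg.tendsto _).comp (hlim x))
      (.inl (by simp))
  simp_rw [hN.lintegral_expNeg_simpleFunc] at h1
  exact tendsto_nhds_unique h1 h2

/-- A random measure is a Poisson random measure if it has the right Laplace functional. -/
theorem IsPoissonRandomMeasure.of_lintegral_expNeg [IsProbabilityMeasure P]
    (hmeas : ∀ B, MeasurableSet B → Measurable fun ω => N ω B)
    (h : ∀ F : E → ℝ≥0∞, Measurable F →
      ∫⁻ ω, expNeg (∫⁻ x, F x ∂N ω) ∂P = expNeg (∫⁻ x, (1 - expNeg (F x)) ∂μ)) :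
    IsPoissonRandomMeasure P μ N := by
  classical
  have hB : ∀ (n : ℕ) (B : Fin n → Set E), (∀ k, MeasurableSet (B k)) →
      Pairwise (fun k l => Disjoint (B k) (B l)) → ∀ θ : Fin n → ℝ≥0,
      ∫⁻ ω, expNeg (∑ k, θ k * N ω (B k)) ∂P =
        expNeg (∑ k, μ (B k) * (1 - expNeg (θ k))) := by
    intro n B hB hd θ
    have hF : Measurable fun x => ∑ k, (B k).indicator (fun _ => (θ k : ℝ≥0∞)) x :=
      Finset.measurable_fun_sum _ fun k _ => measurable_const.indicator (hB k)
    have e := h _ hF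
    -- By disjointness at most one indicator is nonzero at `x`, which makes `1 - expNeg` additive
    -- here.
    have e1 : ∀ x, 1 - expNeg (∑ k, (B k).indicator (fun _ => (θ k : ℝ≥0∞)) x) =
        ∑ k, (B k).indicator (fun _ => 1 - expNeg (θ k)) x := by
      intro x
      by_cases hx : ∃ k, x ∈ B k
      · obtain ⟨k, hk⟩ := hx
        have hl : ∀ l, l ≠ k → x ∉ B l := fun l hlk hxl =>
          Set.disjoint_left.1 (hd hlk) hxl hk
        rw [Finset.sum_eq_single k, Finset.sum_eq_single k] <;> simp +contextual [hk, hl]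
      · push Not at hx
        simp [hx]
    simp_rw [e1, lintegral_finsetSum _ fun k _ => measurable_const.indicator (hB k),
      lintegral_indicator_const (hB _)] at e
    rw [e]
    simp_rw [mul_comm]
  have hone : ∀ B, MeasurableSet B → ∀ θ : ℝ≥0,
      ∫⁻ ω, expNeg (θ * N ω B) ∂P = expNeg (μ B * (1 - expNeg θ)) := by
    intro B hBm θ
    have := hB 1 (fun _ => B) (fun _ => hBm) (fun k l hkl => (hkl (Subsingleton.elim _ _)).elim)
      (fun _ => θ)
    simpa using this
  refine ⟨hmeas, fun B hBm hμ => ?_, fun B hBm hμ => ?_, fun n B hBm hd => ?_⟩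
  · have := Measure.isProbabilityMeasure_map (μ := P) (hmeas B hBm).aemeasurable
    refine ext_of_lintegral_expNeg_mul fun θ => ?_
    rw [lintegral_map (by fun_prop) (hmeas B hBm), hone B hBm,
      lintegral_map (by fun_prop) (by fun_prop)]
    simp_rw [mul_comm (θ : ℝ≥0∞), expNeg_nat_mul]
    rw [lintegral_pow_poissonMeasure _ (expNeg_le_one _), ENNReal.coe_toNNReal hμ]
  · have e := hone B hBm 1
    have h1 : 1 - expNeg (1 : ℝ≥0) ≠ 0 := by
      intro h
      have h2 : expNeg (1 : ℝ≥0) = expNeg 0 := by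
        rw [expNeg_zero]
        exact le_antisymm (expNeg_le_one _) (tsub_eq_zero_iff_le.1 h)
      simpa using expNeg_injective h2
    rw [hμ, ENNReal.top_mul h1, expNeg_top, lintegral_eq_zero_iff
      (by have := hmeas B hBm; fun_prop)] at e
    filter_upwards [e] with ω hω
    refine expNeg_injective ?_
    simpa using hω
  · have := iIndepFun_of_lintegral_expNeg (P := P) (ι := Unit)
      (X := fun k ω (_ : Unit) => N ω (B k))
      (fun k => measurable_pi_lambda _ fun _ => hmeas _ (hBm k)) (fun θ => ?_)
    · exact this.comp (fun k y => y ()) (fun k => by fun_prop)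
    · simp only [Finset.univ_unique, Finset.sum_singleton]
      rw [hB n B hBm hd (fun k => θ k ()), expNeg_sum]
      exact Finset.prod_congr rfl fun k _ => (hone _ (hBm k) _).symm

end PoissonRandomMeasure

/-! ### The point process of the jumps, without its padding. -/

section JumpMeasure

lemma measurableSet_fst_ne_zero {α : Type*} [MeasurableSpace α] :
    MeasurableSet {p : ℝ≥0 × α | p.1 ≠ 0} :=
  measurable_fst (measurableSet_singleton (0 : ℝ≥0)).compl

lemma lintegral_jumpMeasure {Ω : Type*} {W V : ℕ → Ω → ℝ≥0} {F : ℝ≥0 × ℝ≥0 → ℝ≥0∞} (hF : Measurable F) (ω : Ω) :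
    ∫⁻ p, F p ∂jumpMeasure W V ω =
      ∑' i, {p : ℝ≥0 × ℝ≥0 | p.1 ≠ 0}.indicator F (W i ω, V i ω) := by
  rw [jumpMeasure, ← lintegral_indicator measurableSet_fst_ne_zero, lintegral_sum_measure]
  exact tsum_congr fun i =>
    lintegral_dirac' _ (hF.indicator measurableSet_fst_ne_zero)

variable {Ω : Type*} [MeasurableSpace Ω] {W V : ℕ → Ω → ℝ≥0}

lemma measurable_jumpMeasure (hW : ∀ i, Measurable (W i)) (hV : ∀ i, Measurable (V i))
    {B : Set (ℝ≥0 × ℝ≥0)} (hB : MeasurableSet B) :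
    Measurable fun ω => jumpMeasure W V ω B := by
  have e : ∀ ω, jumpMeasure W V ω B =
      ∑' i, {p : ℝ≥0 × ℝ≥0 | p.1 ≠ 0}.indicator (B.indicator 1) (W i ω, V i ω) := fun ω => by
    rw [← lintegral_jumpMeasure (measurable_one.indicator hB), lintegral_indicator_one hB]
  simp_rw [e]
  refine Measurable.tsum fun i => ?_
  exact ((measurable_one.indicator hB).indicator measurableSet_fst_ne_zero).comp
    ((hW i).prodMk (hV i))

/-- Test functions vanishing at weight `0` are enough: `jumpMeasure` drops such points and `ν` does
not charge them. -/
lemma isPoissonRandomMeasure_jumpMeasure {P : Measure Ω} [IsProbabilityMeasure P]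
    {ν : Measure (ℝ≥0 × ℝ≥0)} (hν : ν {p | p.1 = 0} = 0)
    (hW : ∀ i, Measurable (W i)) (hV : ∀ i, Measurable (V i))
    (h : ∀ F : ℝ≥0 × ℝ≥0 → ℝ≥0∞, Measurable F → (∀ v, F (0, v) = 0) →
      ∫⁻ ω, expNeg (∑' i, F (W i ω, V i ω)) ∂P = expNeg (∫⁻ p, (1 - expNeg (F p)) ∂ν)) :
    IsPoissonRandomMeasure P ν (jumpMeasure W V) := by
  refine .of_lintegral_expNeg (fun B hB => measurable_jumpMeasure hW hV hB) fun F hF => ?_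
  simp_rw [lintegral_jumpMeasure hF]
  rw [h _ (hF.indicator measurableSet_fst_ne_zero) (by simp)]
  congr 1
  refine lintegral_congr_ae ?_
  have : ∀ᵐ p ∂ν, p ∈ {p : ℝ≥0 × ℝ≥0 | p.1 ≠ 0} := by
    rw [ae_iff]
    simpa using hν
  filter_upwards [this] with p hp
  rw [indicator_of_mem hp]

lemma lintegral_expNeg_tsum_of_isPoissonRandomMeasure {P : Measure Ω} [IsProbabilityMeasure P]
    {ν : Measure (ℝ≥0 × ℝ≥0)} (hN : IsPoissonRandomMeasure P ν (jumpMeasure W V))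
    {F : ℝ≥0 × ℝ≥0 → ℝ≥0∞} (hF : Measurable F) (hF0 : ∀ v, F (0, v) = 0) :
    ∫⁻ ω, expNeg (∑' i, F (W i ω, V i ω)) ∂P = expNeg (∫⁻ p, (1 - expNeg (F p)) ∂ν) := by
  rw [← hN.lintegral_expNeg hF]
  simp_rw [lintegral_jumpMeasure hF]
  have e : {p : ℝ≥0 × ℝ≥0 | p.1 ≠ 0}.indicator F = F := by
    rw [indicator_eq_self]
    rintro ⟨w, v⟩ hp rfl
    exact hp (hF0 v)
  rw [e]

end JumpMeasure

/-! ### Construction of a Poisson process with s-finite intensity. -/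

section Construction

lemma tendsto_lintegral_prod_expNeg {Ω : Type*} [MeasurableSpace Ω] {P : Measure Ω}
    [IsFiniteMeasure P] {f : ℕ → Ω → ℝ≥0∞} (hf : ∀ i, Measurable (f i)) :
    Tendsto (fun n => ∫⁻ ω, ∏ i ∈ Finset.range n, expNeg (f i ω) ∂P) atTop
      (𝓝 (∫⁻ ω, expNeg (∑' i, f i ω) ∂P)) := by
  refine tendsto_lintegral_of_dominated_convergence (fun _ => 1) (fun n => by fun_prop)
    (fun n => .of_forall fun ω => Finset.prod_le_one' fun i _ => expNeg_le_one _)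
    (by simp) (.of_forall fun ω => tendsto_prod_expNeg _)

lemma exists_isProbabilityMeasure_smul {E : Type*} [MeasurableSpace E] [Nonempty E]
    (μ : Measure E) [IsFiniteMeasure μ] :
    ∃ p : Measure E, IsProbabilityMeasure p ∧ μ = μ univ • p := by
  rcases eq_or_ne μ 0 with rfl | hμ
  · exact ⟨.dirac (Classical.arbitrary E), inferInstance, by simp⟩
  · have h0 : μ univ ≠ 0 := by simpa using hμ
    have : NeZero μ := ⟨hμ⟩
    refine ⟨(μ univ)⁻¹ • μ, inferInstance, ?_⟩
    rw [smul_smul, ENNReal.mul_inv_cancel h0 (measure_ne_top _ _), one_smul]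

/-- For each `n`, a number of points and a sequence from which they are taken. -/
abbrev PointSpace : Type := ℕ → ℕ × (ℕ → ℝ≥0 × ℝ≥0)

/-- The `i`-th point: with `i` encoding `(n, k)`, the `k`-th point of the `n`-th sequence if there
are more than `k` such points, and `0` otherwise. -/
noncomputable def point (i : ℕ) (ω : PointSpace) : ℝ≥0 × ℝ≥0 :=
  if i.unpair.2 < (ω i.unpair.1).1 then (ω i.unpair.1).2 i.unpair.2 else 0

lemma measurable_point (i : ℕ) : Measurable (point i) := by
  refine Measurable.ite ?_ (by fun_prop) measurable_const
  exact measurableSet_lt measurable_const (by fun_prop)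

lemma tsum_point {F : ℝ≥0 × ℝ≥0 → ℝ≥0∞} (hF0 : F 0 = 0) (ω : PointSpace) :
    ∑' i, F (point i ω) = ∑' n, ∑ k ∈ Finset.range (ω n).1, F ((ω n).2 k) := by
  have e : ∀ n k, F (if k < (ω n).1 then (ω n).2 k else 0) =
      if k ∈ Finset.range (ω n).1 then F ((ω n).2 k) else 0 := by
    intro n k
    simp only [Finset.mem_range]
    split_ifs <;> simp [hF0]
  rw [← Nat.pairEquiv.tsum_eq, ENNReal.tsum_prod']
  refine tsum_congr fun n => ?_
  simp only [point, Nat.pairEquiv_apply, Function.uncurry_apply_pair, Nat.unpair_pair, e]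
  rw [tsum_eq_sum (s := Finset.range (ω n).1) (fun k hk => by simp only [if_neg hk])]
  exact Finset.sum_congr rfl fun k hk => by simp only [if_pos hk]

/-- Given the number `n` of points, independence yields `a ^ n` with `a = ∫ e^{-F} dp`; the Poisson
generating function then integrates over `n`. -/
lemma lintegral_expNeg_poisson_sum (r : ℝ≥0) (p : Measure (ℝ≥0 × ℝ≥0)) [IsProbabilityMeasure p]
    {F : ℝ≥0 × ℝ≥0 → ℝ≥0∞} (hF : Measurable F) :
    ∫⁻ q : ℕ × (ℕ → ℝ≥0 × ℝ≥0), expNeg (∑ k ∈ Finset.range q.1, F (q.2 k))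
      ∂(poissonMeasure r).prod (Measure.infinitePi fun _ => p) =
      expNeg (r * ∫⁻ x, (1 - expNeg (F x)) ∂p) := by
  have hm : Measurable fun q : ℕ × (ℕ → ℝ≥0 × ℝ≥0) =>
      expNeg (∑ k ∈ Finset.range q.1, F (q.2 k)) :=
    measurable_from_prod_countable_right fun n => by dsimp only; fun_prop
  rw [lintegral_prod _ hm.aemeasurable]
  have h1 : ∀ n : ℕ, ∫⁻ x : ℕ → ℝ≥0 × ℝ≥0, expNeg (∑ k ∈ Finset.range n, F (x k))
      ∂(Measure.infinitePi fun _ => p) = (∫⁻ x, expNeg (F x) ∂p) ^ n := by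
    intro n
    simp_rw [expNeg_sum]
    rw [lintegral_prod_eq_prod_lintegral_of_indepFun (Finset.range n)
      (fun k (x : ℕ → ℝ≥0 × ℝ≥0) => expNeg (F (x k)))
      (iIndepFun_infinitePi (X := fun _ x => expNeg (F x)) fun _ => by fun_prop)
      (fun k => by fun_prop)]
    rw [Finset.prod_eq_pow_card (b := ∫⁻ x, expNeg (F x) ∂p), Finset.card_range]
    intro k _
    have := (measurePreserving_eval_infinitePi (fun _ : ℕ => p) k).lintegral_comp
      (f := fun x => expNeg (F x)) (by fun_prop)
    simpa using this
  simp_rw [h1]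
  have hle : ∫⁻ x, expNeg (F x) ∂p ≤ 1 := by
    calc ∫⁻ x, expNeg (F x) ∂p ≤ ∫⁻ _, 1 ∂p := lintegral_mono fun x => expNeg_le_one _
      _ = 1 := by simp
  rw [lintegral_pow_poissonMeasure r hle, lintegral_sub (by fun_prop)
    (hle.trans_lt (by simp)).ne (.of_forall fun x => expNeg_le_one _)]
  simp

/-- A point process with a given Laplace functional exists on `PointSpace`. -/
theorem exists_measure_pointSpace (ν : Measure (ℝ≥0 × ℝ≥0)) [SFinite ν] :
    ∃ Q : Measure PointSpace, IsProbabilityMeasure Q ∧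
      ∀ F : ℝ≥0 × ℝ≥0 → ℝ≥0∞, Measurable F → F 0 = 0 →
        ∫⁻ ω, expNeg (∑' i, F (point i ω)) ∂Q = expNeg (∫⁻ p, (1 - expNeg (F p)) ∂ν) := by
  -- `ν` is a countable sum of finite measures. Each is realized by a Poisson number of i.i.d.
  -- points, and superposing the independent clouds adds their Laplace exponents.
  choose p hp hpe using fun n => exists_isProbabilityMeasure_smul (sfiniteSeq ν n)
  let r : ℕ → ℝ≥0 := fun n => (sfiniteSeq ν n univ).toNNReal
  have hr : ∀ n, (r n : ℝ≥0∞) = sfiniteSeq ν n univ := fun n =>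
    ENNReal.coe_toNNReal (measure_ne_top _ _)
  let R : ℕ → Measure (ℕ × (ℕ → ℝ≥0 × ℝ≥0)) := fun n =>
    (poissonMeasure (r n)).prod (Measure.infinitePi fun _ => p n)
  refine ⟨Measure.infinitePi R, inferInstance, fun F hF hF0 => ?_⟩
  let S : ℕ × (ℕ → ℝ≥0 × ℝ≥0) → ℝ≥0∞ := fun q => ∑ k ∈ Finset.range q.1, F (q.2 k)
  have hS : Measurable S :=
    measurable_from_prod_countable_right fun n => by dsimp only [S]; fun_prop
  have hlap : ∀ n, ∫⁻ ω, expNeg (S (ω n)) ∂(Measure.infinitePi R) =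
      expNeg (∫⁻ x, (1 - expNeg (F x)) ∂sfiniteSeq ν n) := by
    intro n
    have := (measurePreserving_eval_infinitePi R n).lintegral_comp
      (f := fun q => expNeg (S q)) (by fun_prop)
    simp only [Function.eval] at this
    rw [this, lintegral_expNeg_poisson_sum (r n) (p n) hF, hr]
    conv_rhs => rw [hpe n]
    rw [lintegral_smul_measure, smul_eq_mul]
  simp_rw [tsum_point hF0]
  have h1 := tendsto_lintegral_prod_expNeg (P := Measure.infinitePi R)
    (f := fun n ω => S (ω n)) (fun n => by fun_prop)
  have h2 : ∀ m, ∫⁻ ω, ∏ n ∈ Finset.range m, expNeg (S (ω n)) ∂(Measure.infinitePi R) =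
      ∏ n ∈ Finset.range m, expNeg (∫⁻ x, (1 - expNeg (F x)) ∂sfiniteSeq ν n) := by
    intro m
    rw [lintegral_prod_eq_prod_lintegral_of_indepFun (Finset.range m)
      (fun n (ω : PointSpace) => expNeg (S (ω n)))
      (iIndepFun_infinitePi (X := fun _ x => expNeg (S x)) fun _ => by fun_prop)
      (fun k => by fun_prop)]
    simp_rw [hlap]
  simp_rw [h2] at h1
  rw [tendsto_nhds_unique h1 (tendsto_prod_expNeg _), ← lintegral_sum_measure, sum_sfiniteSeq]

end Construction

/-! ### Integrating out independent marks. -/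

section Marking

variable {Ω 𝓧 𝓜 : Type*} [MeasurableSpace Ω] [MeasurableSpace 𝓧] [MeasurableSpace 𝓜]
  {P : Measure Ω} [IsProbabilityMeasure P] {ρ : Measure 𝓜}
  {X : ℕ → Ω → 𝓧} {M : ℕ → Ω → 𝓜}

/-- Independent marks may be integrated out in the Laplace functional of a sequence of points. -/
theorem lintegral_expNeg_tsum_marked [IsProbabilityMeasure ρ] (hX : ∀ i, Measurable (X i))
    (hM : ∀ i, Measurable (M i)) (hlaw : ∀ i, P.map (M i) = ρ) (hiM : iIndepFun M P)
    (hMX : IndepFun (fun ω i => M i ω) (fun ω i => X i ω) P)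
    {F : 𝓧 × 𝓜 → ℝ≥0∞} (hF : Measurable F) :
    ∫⁻ ω, expNeg (∑' i, F (X i ω, M i ω)) ∂P =
      ∫⁻ ω, expNeg (∑' i, negLog (∫⁻ m, expNeg (F (X i ω, m)) ∂ρ)) ∂P := by
  have hle : ∀ x, ∫⁻ m, expNeg (F (x, m)) ∂ρ ≤ 1 := fun x => by
    calc ∫⁻ m, expNeg (F (x, m)) ∂ρ ≤ ∫⁻ _, 1 ∂ρ := lintegral_mono fun _ => expNeg_le_one _
      _ = 1 := by simp
  have hg : Measurable fun x => ∫⁻ m, expNeg (F (x, m)) ∂ρ :=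
    Measurable.lintegral_prod_right' (f := fun q => expNeg (F q)) (by fun_prop)
  have hXs : Measurable fun ω i => X i ω := measurable_pi_lambda _ hX
  have hMs : Measurable fun ω i => M i ω := measurable_pi_lambda _ hM
  -- Both sides are limits of integrals of finite products, where independence applies. There
  -- `expNeg` undoes `negLog`, since the mark averages are at most `1`.
  have h1 := tendsto_lintegral_prod_expNeg (P := P) (f := fun i ω => F (X i ω, M i ω))
    (fun i => by fun_prop)
  have h2 := tendsto_lintegral_prod_expNeg (P := P)
    (f := fun i ω => negLog (∫⁻ m, expNeg (F (X i ω, m)) ∂ρ))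
    (fun i => measurable_negLog.comp (hg.comp (hX i)))
  refine tendsto_nhds_unique h1 (h2.congr fun n => ?_)
  simp_rw [expNeg_negLog (hle _)]
  have := Measure.isProbabilityMeasure_map (μ := P) hXs.aemeasurable
  have := Measure.isProbabilityMeasure_map (μ := P) hMs.aemeasurable
  have hG : Measurable fun q : (ℕ → 𝓜) × (ℕ → 𝓧) =>
      ∏ i ∈ Finset.range n, expNeg (F (q.2 i, q.1 i)) := by fun_prop
  symm
  calc ∫⁻ ω, ∏ i ∈ Finset.range n, expNeg (F (X i ω, M i ω)) ∂P
      = ∫⁻ q, ∏ i ∈ Finset.range n, expNeg (F (q.2 i, q.1 i))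
          ∂P.map fun ω => ((fun i => M i ω), fun i => X i ω) :=
        (lintegral_map hG (hMs.prodMk hXs)).symm
    _ = ∫⁻ x, ∫⁻ m, ∏ i ∈ Finset.range n, expNeg (F (x i, m i)) ∂P.map (fun ω i => M i ω)
          ∂P.map fun ω i => X i ω := by
        rw [hMX.map_prod_eq_prod_map_map hMs.aemeasurable hXs.aemeasurable,
          lintegral_prod_symm _ hG.aemeasurable]
    _ = ∫⁻ x, ∏ i ∈ Finset.range n, ∫⁻ m, expNeg (F (x i, m)) ∂ρ ∂P.map fun ω i => X i ω := by
        refine lintegral_congr fun x => ?_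
        rw [lintegral_map (by fun_prop) hMs,
          lintegral_prod_eq_prod_lintegral_of_indepFun (Finset.range n)
            (fun i ω => expNeg (F (x i, M i ω)))
            (hiM.comp (fun i m => expNeg (F (x i, m))) fun i => by fun_prop)
            (fun i => by fun_prop)]
        refine Finset.prod_congr rfl fun i _ => ?_
        rw [← hlaw i, lintegral_map (by fun_prop) (hM i)]
    _ = _ := by
        have hg' : Measurable fun x : ℕ → 𝓧 =>
            ∏ i ∈ Finset.range n, ∫⁻ m, expNeg (F (x i, m)) ∂ρ :=
          Finset.measurable_fun_prod _ fun i _ => hg.comp (measurable_pi_apply i)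
        rw [lintegral_map hg' hXs]

end Marking

/-! ### Marked Poisson processes: Laplace functional, independence, finiteness. -/

section Marked

/-- The points `(W_i, V_i)` form a Poisson process with intensity `ν`, and the `M_i` are
independent marks with law `ρ`. -/
structure IsMarkedPoisson {Ω : Type*} [MeasurableSpace Ω] (P : Measure Ω) {d : ℕ}
    (ν : Measure (ℝ≥0 × ℝ≥0)) (ρ : Measure (Fin d → ℝ≥0)) (W V : ℕ → Ω → ℝ≥0)
    (M : ℕ → Ω → Fin d → ℝ≥0) : Prop where
  measurable_weight : ∀ i, Measurable (W i)
  measurable_time : ∀ i, Measurable (V i)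
  poisson : IsPoissonRandomMeasure P ν (jumpMeasure W V)
  measurable_mark : ∀ i, Measurable (M i)
  law : ∀ i, P.map (M i) = ρ
  iIndep : iIndepFun M P
  indep : IndepFun (fun ω i => M i ω) (fun ω i => (W i ω, V i ω)) P

/-- The intensity of the jumps `M_i W_i` at the times `V_i`. -/
noncomputable def markedIntensity {d : ℕ} (ν : Measure (ℝ≥0 × ℝ≥0)) (ρ : Measure (Fin d → ℝ≥0)) :
    Measure ((Fin d → ℝ≥0) × ℝ≥0) :=
  (ν.prod ρ).map fun q => (fun j => q.2 j * q.1.1, q.1.2)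

/-- The `j`-th coordinate of the jump at `((w, v), m)` if its time is in `A`. -/
noncomputable def jump {d : ℕ} (j : Fin d) (A : Set ℝ≥0) (q : (ℝ≥0 × ℝ≥0) × (Fin d → ℝ≥0)) : ℝ≥0 :=
  q.2 j * q.1.1 * A.indicator 1 q.1.2

variable {d : ℕ}

lemma measurable_jump (j : Fin d) {A : Set ℝ≥0} (hA : MeasurableSet A) :
    Measurable (jump j A) := by
  have : Measurable (A.indicator (1 : ℝ≥0 → ℝ≥0)) := measurable_one.indicator hA
  unfold jump
  fun_prop

lemma jump_zero (j : Fin d) (A : Set ℝ≥0) (v : ℝ≥0) (m : Fin d → ℝ≥0) :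
    jump j A ((0, v), m) = 0 := by
  simp [jump]

lemma jump_of_mem (j : Fin d) {A : Set ℝ≥0} {q : (ℝ≥0 × ℝ≥0) × (Fin d → ℝ≥0)} (h : q.1.2 ∈ A) :
    jump j A q = q.2 j * q.1.1 := by
  simp [jump, h]

lemma jump_of_notMem (j : Fin d) {A : Set ℝ≥0} {q : (ℝ≥0 × ℝ≥0) × (Fin d → ℝ≥0)}
    (h : q.1.2 ∉ A) : jump j A q = 0 := by
  simp [jump, h]

lemma jump_Iic_eq_add (j : Fin d) {s t : ℝ≥0} (hst : s ≤ t)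
    (q : (ℝ≥0 × ℝ≥0) × (Fin d → ℝ≥0)) :
    jump j (Iic t) q = jump j (Iic s) q + jump j (Ioc s t) q := by
  by_cases h1 : q.1.2 ≤ s
  · rw [jump_of_mem j (h1.trans hst : q.1.2 ∈ Iic t), jump_of_mem j (h1 : q.1.2 ∈ Iic s),
      jump_of_notMem j (fun h => h.1.not_ge h1), add_zero]
  · rw [jump_of_notMem j (A := Iic s) h1, zero_add]
    by_cases h2 : q.1.2 ≤ t
    · rw [jump_of_mem j (A := Iic t) h2, jump_of_mem j (A := Ioc s t) ⟨not_le.1 h1, h2⟩]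
    · rw [jump_of_notMem j (A := Iic t) h2, jump_of_notMem j (fun h => h2 h.2)]

/-- The condition `G 0 = 0` removes the points after time `T`, whose truncated jump is `0`. -/
lemma lintegral_jump_Iic {ν : Measure (ℝ≥0 × ℝ≥0)} {ρ : Measure (Fin d → ℝ≥0)}
    {G : (Fin d → ℝ≥0) → ℝ≥0∞} (hG : Measurable G) (hG0 : G 0 = 0) (T : ℝ≥0) :
    ∫⁻ q, G (fun j => jump j (Iic T) q) ∂(ν.prod ρ) =
      ∫⁻ p in {p | p.2 ≤ T}, G p.1 ∂(markedIntensity ν ρ) := by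
  have hT : MeasurableSet {p : (Fin d → ℝ≥0) × ℝ≥0 | p.2 ≤ T} :=
    measurableSet_le measurable_snd measurable_const
  rw [← lintegral_indicator hT, markedIntensity,
    lintegral_map (Measurable.indicator (f := fun p : (Fin d → ℝ≥0) × ℝ≥0 => G p.1)
      (by fun_prop) hT) (by fun_prop)]
  refine lintegral_congr fun q => ?_
  by_cases h : q.1.2 ≤ T
  · rw [indicator_of_mem (by exact h)]
    simp_rw [jump_of_mem _ (show q.1.2 ∈ Iic T from h)]
  · rw [indicator_of_notMem (by exact h)]
    simp_rw [jump_of_notMem _ (show q.1.2 ∉ Iic T from h)]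
    exact hG0

/-- Excludes an infinite Laplace exponent, which `toReal` would turn into `0`. -/
lemma IsLevyIntensity.lintegral_one_sub_expNeg_lt_top {ν : Measure ((Fin d → ℝ≥0) × ℝ≥0)}
    (hν : IsLevyIntensity ν) (T : ℝ≥0) (θ : Fin d → ℝ≥0) :
    ∫⁻ p in {p | p.2 ≤ T}, (1 - expNeg ((∑ j, θ j * p.1 j : ℝ≥0) : ℝ≥0∞)) ∂ν < ∞ := by
  -- `C` dominates both `1` and every `θ j`, one bound for each branch of the minimum.
  set C : ℝ≥0 := 1 + ∑ j, θ j with hC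
  have hbound : ∀ s : Fin d → ℝ≥0, 1 - expNeg ((∑ j, θ j * s j : ℝ≥0) : ℝ≥0∞) ≤
      C * ((min 1 (∑ j, s j) : ℝ≥0) : ℝ≥0∞) := by
    intro s
    refine (one_sub_expNeg_le _).trans ?_
    have h1 : min 1 (∑ j, θ j * s j) ≤ C * min 1 (∑ j, s j) := by
      rcases le_total 1 (∑ j, s j) with h | h
      · rw [min_eq_left h, mul_one]
        exact (min_le_left _ _).trans (by simp [hC])
      · rw [min_eq_right h, Finset.mul_sum]
        refine (min_le_right _ _).trans (Finset.sum_le_sum fun j _ => ?_)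
        gcongr
        exact (Finset.single_le_sum (f := θ) (fun _ _ => zero_le) (Finset.mem_univ j)).trans
          le_add_self
    exact_mod_cast h1
  calc ∫⁻ p in {p | p.2 ≤ T}, (1 - expNeg ((∑ j, θ j * p.1 j : ℝ≥0) : ℝ≥0∞)) ∂ν
      ≤ ∫⁻ p in {p | p.2 ≤ T}, C * ((min 1 (∑ j, p.1 j) : ℝ≥0) : ℝ≥0∞) ∂ν :=
        lintegral_mono fun p => hbound p.1
    _ = C * ∫⁻ p in {p | p.2 ≤ T}, ((min 1 (∑ j, p.1 j) : ℝ≥0) : ℝ≥0∞) ∂ν :=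
        lintegral_const_mul _ (by fun_prop)
    _ < ∞ := ENNReal.mul_lt_top (by simp) (hν.integrable T)

variable {Ω : Type*} [MeasurableSpace Ω] {P : Measure Ω} [IsProbabilityMeasure P]
  {ν : Measure (ℝ≥0 × ℝ≥0)} {ρ : Measure (Fin d → ℝ≥0)} [IsProbabilityMeasure ρ]
  {W V : ℕ → Ω → ℝ≥0} {M : ℕ → Ω → Fin d → ℝ≥0}

omit [IsProbabilityMeasure P] [IsProbabilityMeasure ρ] in
lemma IsMarkedPoisson.measurable_point (h : IsMarkedPoisson P ν ρ W V M) (i : ℕ) :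
    Measurable fun ω => ((W i ω, V i ω), M i ω) :=
  ((h.measurable_weight i).prodMk (h.measurable_time i)).prodMk (h.measurable_mark i)

/-- The Laplace functional of a marked Poisson process. -/
theorem IsMarkedPoisson.lintegral_expNeg (h : IsMarkedPoisson P ν ρ W V M)
    {F : (ℝ≥0 × ℝ≥0) × (Fin d → ℝ≥0) → ℝ≥0∞} (hF : Measurable F)
    (hF0 : ∀ v m, F ((0, v), m) = 0) :
    ∫⁻ ω, expNeg (∑' i, F ((W i ω, V i ω), M i ω)) ∂P =
      expNeg (∫⁻ q, (1 - expNeg (F q)) ∂(ν.prod ρ)) := by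
  have hg : Measurable fun x => ∫⁻ m, expNeg (F (x, m)) ∂ρ :=
    Measurable.lintegral_prod_right' (f := fun q => expNeg (F q)) (by fun_prop)
  have hle : ∀ x, ∫⁻ m, expNeg (F (x, m)) ∂ρ ≤ 1 := fun x => by
    calc ∫⁻ m, expNeg (F (x, m)) ∂ρ ≤ ∫⁻ _, 1 ∂ρ := lintegral_mono fun _ => expNeg_le_one _
      _ = 1 := by simp
  rw [lintegral_expNeg_tsum_marked (X := fun i ω => (W i ω, V i ω))
    (fun i => (h.measurable_weight i).prodMk (h.measurable_time i)) h.measurable_mark h.law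
    h.iIndep h.indep hF,
    lintegral_expNeg_tsum_of_isPoissonRandomMeasure h.poisson
      (F := fun x => negLog (∫⁻ m, expNeg (F (x, m)) ∂ρ)) (measurable_negLog.comp hg)
      (fun v => by simp [hF0, negLog]),
    lintegral_prod _ (by fun_prop)]
  congr 1
  refine lintegral_congr fun x => ?_
  rw [expNeg_negLog (hle x), lintegral_sub (by fun_prop) ((hle x).trans_lt (by simp)).ne
    (.of_forall fun m => expNeg_le_one _)]
  simp

/-- Sums over disjoint sets of points of a marked Poisson process have a factorizing Laplace
transform. -/
theorem IsMarkedPoisson.lintegral_expNeg_sum (h : IsMarkedPoisson P ν ρ W V M)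
    {κ : Type*} [Fintype κ] {F : κ → (ℝ≥0 × ℝ≥0) × (Fin d → ℝ≥0) → ℝ≥0∞}
    (hF : ∀ k, Measurable (F k)) (hF0 : ∀ k v m, F k ((0, v), m) = 0)
    (hd : ∀ k l, k ≠ l → ∀ q, F k q = 0 ∨ F l q = 0) :
    ∫⁻ ω, expNeg (∑ k, ∑' i, F k ((W i ω, V i ω), M i ω)) ∂P =
      ∏ k, ∫⁻ ω, expNeg (∑' i, F k ((W i ω, V i ω), M i ω)) ∂P := by
  have e1 : ∀ ω, ∑ k, ∑' i, F k ((W i ω, V i ω), M i ω) =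
      ∑' i, ∑ k, F k ((W i ω, V i ω), M i ω) := fun ω =>
    (Summable.tsum_finsetSum fun _ _ => ENNReal.summable).symm
  -- At most one `F k` is nonzero at `q`, so the exponent is additive and its exponential
  -- factorizes.
  have e2 : ∀ q, 1 - expNeg (∑ k, F k q) = ∑ k, (1 - expNeg (F k q)) := by
    intro q
    by_cases hq : ∃ k, F k q ≠ 0
    · obtain ⟨k, hk⟩ := hq
      have hl : ∀ l, l ≠ k → F l q = 0 := fun l hlk => (hd l k hlk q).resolve_right hk
      rw [Finset.sum_eq_single k, Finset.sum_eq_single k] <;> simp +contextual [hl]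
    · push Not at hq
      simp [hq]
  simp_rw [e1]
  rw [h.lintegral_expNeg (F := fun q => ∑ k, F k q) (Finset.measurable_fun_sum _ fun k _ => hF k)
    (fun v m => by simp [hF0])]
  simp_rw [e2]
  rw [lintegral_finsetSum _ (fun k _ => by have := hF k; fun_prop), expNeg_sum]
  exact Finset.prod_congr rfl fun k _ => (h.lintegral_expNeg (hF k) (hF0 k)).symm

/-- Sums over disjoint sets of points of a marked Poisson process are independent. -/
theorem IsMarkedPoisson.iIndepFun_tsum (h : IsMarkedPoisson P ν ρ W V M)
    {κ ι : Type*} [Fintype κ] [Fintype ι] {f : κ → ι → (ℝ≥0 × ℝ≥0) × (Fin d → ℝ≥0) → ℝ≥0∞}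
    (hf : ∀ k i, Measurable (f k i)) (hf0 : ∀ k i v m, f k i ((0, v), m) = 0)
    (hd : ∀ k l, k ≠ l → ∀ q, (∀ i, f k i q = 0) ∨ ∀ i, f l i q = 0) :
    iIndepFun (fun k ω i => ∑' n, f k i ((W n ω, V n ω), M n ω)) P := by
  refine iIndepFun_of_lintegral_expNeg (fun k => measurable_pi_lambda _ fun i =>
    Measurable.tsum fun n => (hf k i).comp (h.measurable_point n)) fun θ => ?_
  have e : ∀ k ω, ∑ i, θ k i * ∑' n, f k i ((W n ω, V n ω), M n ω) =
      ∑' n, ∑ i, θ k i * f k i ((W n ω, V n ω), M n ω) := by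
    intro k ω
    rw [Summable.tsum_finsetSum fun _ _ => ENNReal.summable]
    simp_rw [ENNReal.tsum_mul_left]
  simp_rw [e]
  refine h.lintegral_expNeg_sum (F := fun k q => ∑ i, θ k i * f k i q)
    (fun k => Finset.measurable_fun_sum _ fun i _ => (hf k i).const_mul _)
    (fun k v m => by simp [hf0]) fun k l hkl q => ?_
  rcases hd k l hkl q with h0 | h0
  · exact .inl (by simp [h0])
  · exact .inr (by simp [h0])

theorem IsMarkedPoisson.lintegral_expNeg_jump (h : IsMarkedPoisson P ν ρ W V M) (T : ℝ≥0)
    (θ : Fin d → ℝ≥0) :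
    ∫⁻ ω, expNeg (∑ j, θ j * ∑' i, (jump j (Iic T) ((W i ω, V i ω), M i ω) : ℝ≥0∞)) ∂P =
      expNeg (∫⁻ p in {p | p.2 ≤ T}, (1 - expNeg ((∑ j, θ j * p.1 j : ℝ≥0) : ℝ≥0∞))
        ∂(markedIntensity ν ρ)) := by
  have hj : ∀ j : Fin d, Measurable (jump j (Iic T)) := fun j => measurable_jump j measurableSet_Iic
  have e : ∀ ω, ∑ j, θ j * ∑' i, (jump j (Iic T) ((W i ω, V i ω), M i ω) : ℝ≥0∞) =
      ∑' i, ((∑ j, θ j * jump j (Iic T) ((W i ω, V i ω), M i ω) : ℝ≥0) : ℝ≥0∞) := by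
    intro ω
    push_cast
    rw [Summable.tsum_finsetSum fun _ _ => ENNReal.summable]
    simp_rw [ENNReal.tsum_mul_left]
  simp_rw [e]
  rw [h.lintegral_expNeg (F := fun q => ((∑ j, θ j * jump j (Iic T) q : ℝ≥0) : ℝ≥0∞))
    (by fun_prop) (fun v m => by simp [jump_zero]),
    lintegral_jump_Iic (G := fun s => 1 - expNeg ((∑ j, θ j * s j : ℝ≥0) : ℝ≥0∞))
      (by fun_prop) (by simp)]

/-- For the total jump `S` up to `T` and `c > 0`, `E exp (-c S) ≤ P (S < ∞)`. As `c → 0` the Laplace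
exponent tends to `0` by dominated convergence, so the right side is `1`. -/
theorem IsMarkedPoisson.ae_tsum_jump_ne_top (h : IsMarkedPoisson P ν ρ W V M)
    (hν : IsLevyIntensity (markedIntensity ν ρ)) :
    ∀ᵐ ω ∂P, ∀ (T : ℝ≥0) (j : Fin d),
      ∑' i, (jump j (Iic T) ((W i ω, V i ω), M i ω) : ℝ≥0∞) ≠ ∞ := by
  have key : ∀ T : ℝ≥0, ∀ᵐ ω ∂P, ∀ j : Fin d,
      ∑' i, (jump j (Iic T) ((W i ω, V i ω), M i ω) : ℝ≥0∞) ≠ ∞ := by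
    intro T
    let S : Ω → ℝ≥0∞ := fun ω =>
      ∑ j : Fin d, ∑' i, (jump j (Iic T) ((W i ω, V i ω), M i ω) : ℝ≥0∞)
    have hS : Measurable S := Finset.measurable_fun_sum _ fun j _ => Measurable.tsum fun i =>
      ((measurable_jump j measurableSet_Iic).comp (h.measurable_point i)).coe_nnreal_ennreal
    have hSm : MeasurableSet {ω | S ω ≠ ∞} := hS (measurableSet_singleton ∞).compl
    -- Positivity makes `exp (-c S)` vanish on `S = ∞`; `c ≤ 1` keeps the integrands below `min 1 (∑
    -- j, s j)`.
    let c : ℕ → ℝ≥0 := fun n => 1 / ((n : ℝ≥0) + 1)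
    have hc : Tendsto c atTop (𝓝 0) := 
      tendsto_one_div_add_atTop_nhds_zero_nat
    have hc0 : ∀ n, (c n : ℝ≥0∞) ≠ 0 := fun n => by simp [c]
    have hc1 : ∀ n, c n ≤ 1 := fun n => by
      simp only [c]
      rw [div_le_one (by positivity)]
      simp
    have hlim : Tendsto (fun n => ∫⁻ p in {p | p.2 ≤ T},
        (1 - expNeg ((∑ j, c n * p.1 j : ℝ≥0) : ℝ≥0∞)) ∂(markedIntensity ν ρ)) atTop (𝓝 0) := by
      have := tendsto_lintegral_of_dominated_convergence
        (μ := (markedIntensity ν ρ).restrict {p | p.2 ≤ T})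
        (F := fun n p => 1 - expNeg ((∑ j, c n * p.1 j : ℝ≥0) : ℝ≥0∞)) (f := fun _ => 0)
        (fun p => ((min 1 (∑ j, p.1 j) : ℝ≥0) : ℝ≥0∞)) (fun n => by fun_prop)
        (fun n => .of_forall fun p => ?_) (hν.integrable T).ne (.of_forall fun p => ?_)
      · simpa using this
      · refine (one_sub_expNeg_le _).trans ?_
        have h1 : ∑ j, c n * p.1 j ≤ ∑ j, p.1 j :=
          Finset.sum_le_sum fun j _ => mul_le_of_le_one_left zero_le (hc1 n)
        have h2 := min_le_min_left 1 h1
        dsimp only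
        exact_mod_cast h2
      · have h2 : Tendsto (fun n => ∑ j, c n * p.1 j) atTop (𝓝 (∑ j, 0 * p.1 j)) :=
          tendsto_finsetSum _ fun j _ => hc.mul_const _
        have h3 := ENNReal.Tendsto.sub (tendsto_const_nhds (x := (1 : ℝ≥0∞)) (f := atTop))
          ((continuous_expNeg.tendsto _).comp (ENNReal.tendsto_coe.2 h2)) (.inl (by simp))
        simpa using h3
    have hle : ∀ n, expNeg (∫⁻ p in {p | p.2 ≤ T},
        (1 - expNeg ((∑ j, c n * p.1 j : ℝ≥0) : ℝ≥0∞)) ∂(markedIntensity ν ρ)) ≤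
        P {ω | S ω ≠ ∞} := by
      intro n
      rw [← h.lintegral_expNeg_jump T fun _ => c n, ← lintegral_indicator_one hSm]
      refine lintegral_mono fun ω => ?_
      rw [← Finset.mul_sum]
      by_cases hω : S ω = ∞
      · have : expNeg (c n * S ω) = 0 := by rw [hω, ENNReal.mul_top (hc0 n), expNeg_top]
        exact this.le.trans zero_le
      · rw [indicator_of_mem (by exact hω)]
        exact expNeg_le_one _
    have hone : 1 ≤ P {ω | S ω ≠ ∞} := by
      have := (continuous_expNeg.tendsto _).comp hlim
      rw [expNeg_zero] at this
      exact le_of_tendsto this (.of_forall hle)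
    have hae : ∀ᵐ ω ∂P, S ω ≠ ∞ :=
      (mem_ae_iff_prob_eq_one hSm).2 (le_antisymm prob_le_one hone)
    filter_upwards [hae] with ω hω j
    exact fun hj => hω (ENNReal.sum_eq_top.2 ⟨j, Finset.mem_univ j, hj⟩)
  -- The sums increase with `T`, so integer horizons give one null set for all `T`.
  filter_upwards [ae_all_iff.2 fun n : ℕ => key n] with ω hω T j
  obtain ⟨n, hn⟩ := exists_nat_ge T
  refine ne_top_of_le_ne_top (hω n j) (ENNReal.tsum_le_tsum fun i => ?_)
  rw [jump_Iic_eq_add j hn]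
  push_cast
  exact le_self_add

end Marked

/-! ### The series of marked jumps is a vector of subordinators. -/

section SubordinatorVector

/-- A series of nonnegative terms, each switched on at its own time, is right-continuous. -/
lemma continuousWithinAt_tsum_indicator {a v : ℕ → ℝ≥0}
    (hs : ∀ t : ℝ≥0, Summable fun i => a i * {x | x ≤ t}.indicator 1 (v i)) (t : ℝ≥0) :
    ContinuousWithinAt (fun s => ∑' i, a i * {x | x ≤ s}.indicator 1 (v i)) (Ici t) t := by
  rw [ContinuousWithinAt, ← NNReal.tendsto_coe]
  simp only [NNReal.coe_tsum]
  -- Each term is constant for `s` slightly above `t`, and the summable terms at time `t + 1`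
  -- dominate.
  refine tendsto_tsum_of_dominated_convergence
    (bound := fun i => ((a i * {x | x ≤ t + 1}.indicator 1 (v i) : ℝ≥0) : ℝ))
    (NNReal.summable_coe.2 (hs (t + 1))) (fun i => ?_) ?_
  · refine tendsto_const_nhds.congr' ?_
    by_cases h : v i ≤ t
    · filter_upwards [self_mem_nhdsWithin] with s hs
      rw [indicator_of_mem (by exact h), indicator_of_mem (by exact h.trans hs)]
    · have : ∀ᶠ s in 𝓝[≥] t, s < v i :=
        (eventually_lt_nhds (not_le.1 h)).filter_mono nhdsWithin_le_nhds
      filter_upwards [this] with s hs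
      rw [indicator_of_notMem (by exact h), indicator_of_notMem (by simpa using hs)]
  · have : ∀ᶠ s in 𝓝[≥] t, s < t + 1 :=
      (eventually_lt_nhds (lt_add_one t)).filter_mono nhdsWithin_le_nhds
    filter_upwards [this] with s hs i
    rw [NNReal.norm_eq, NNReal.coe_le_coe]
    gcongr

variable {d : ℕ} {Ω : Type*} [MeasurableSpace Ω] {P : Measure Ω} [IsProbabilityMeasure P]
  {ν : Measure (ℝ≥0 × ℝ≥0)} {ρ : Measure (Fin d → ℝ≥0)} [IsProbabilityMeasure ρ]
  {W V : ℕ → Ω → ℝ≥0} {M : ℕ → Ω → Fin d → ℝ≥0}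

theorem IsMarkedPoisson.ae_summable (h : IsMarkedPoisson P ν ρ W V M)
    (hν : IsLevyIntensity (markedIntensity ν ρ)) :
    ∀ᵐ ω ∂P, ∀ (t : ℝ≥0) (j : Fin d),
      Summable fun i => M i ω j * W i ω * {x | x ≤ t}.indicator 1 (V i ω) := by
  filter_upwards [h.ae_tsum_jump_ne_top hν] with ω hω t j
  exact ENNReal.tsum_coe_ne_top_iff_summable.1 (hω t j)

lemma integral_exp_neg_eq_toReal {α : Type*} [MeasurableSpace α] {μ : Measure α} {f : α → ℝ≥0}
    (hf : Measurable f) :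
    ∫ x, Real.exp (-(f x : ℝ)) ∂μ = (∫⁻ x, expNeg (f x) ∂μ).toReal := by
  rw [integral_eq_lintegral_of_nonneg_ae (.of_forall fun x => by positivity)
    (Measurable.aestronglyMeasurable (by fun_prop))]
  simp_rw [expNeg_coe]

lemma integral_one_sub_exp_neg_eq_toReal {α : Type*} [MeasurableSpace α] {μ : Measure α}
    {f : α → ℝ≥0} (hf : Measurable f) :
    ∫ x, (1 - Real.exp (-(f x : ℝ))) ∂μ = (∫⁻ x, (1 - expNeg (f x)) ∂μ).toReal := by
  rw [integral_eq_lintegral_of_nonneg_ae (.of_forall fun x => by simp)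
    (Measurable.aestronglyMeasurable (by fun_prop))]
  simp_rw [expNeg_coe, ENNReal.ofReal_sub _ (Real.exp_nonneg _), ENNReal.ofReal_one]

/-- The series with marked Poisson jumps is a vector of subordinators. -/
theorem IsMarkedPoisson.isSubordinatorVector (h : IsMarkedPoisson P ν ρ W V M)
    (hν : IsLevyIntensity (markedIntensity ν ρ)) :
    IsSubordinatorVector P (markedIntensity ν ρ) fun t ω j =>
      ∑' i, M i ω j * W i ω * {x | x ≤ t}.indicator 1 (V i ω) := by
  have hsum := h.ae_summable hν
  have hj : ∀ (j : Fin d) {A : Set ℝ≥0}, MeasurableSet A →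
      Measurable fun q => (jump j A q : ℝ≥0∞) := fun j A hA =>
    (measurable_jump j hA).coe_nnreal_ennreal
  set Y : ℝ≥0 → Ω → Fin d → ℝ≥0 := fun t ω j =>
    ∑' i, M i ω j * W i ω * {x | x ≤ t}.indicator 1 (V i ω) with hY
  have hYj : ∀ t ω j, Y t ω j = ∑' i, jump j (Iic t) ((W i ω, V i ω), M i ω) :=
    fun t ω j => rfl
  have hYm : ∀ t, Measurable (Y t) := fun t => measurable_pi_lambda _ fun j => by
    simp_rw [hYj]
    exact Measurable.tsum fun i => (measurable_jump j measurableSet_Iic).comp (h.measurable_point i)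
  have hcoe : ∀ᵐ ω ∂P, ∀ (t : ℝ≥0) (j : Fin d), (Y t ω j : ℝ≥0∞) =
      ∑' i, (jump j (Iic t) ((W i ω, V i ω), M i ω) : ℝ≥0∞) := by
    filter_upwards [hsum] with ω hω t j
    exact ENNReal.coe_tsum (hω t j)
  have hincr : ∀ᵐ ω ∂P, ∀ (s t : ℝ≥0) (j : Fin d), s ≤ t → (Y t ω j : ℝ) - Y s ω j =
      (∑' i, (jump j (Ioc s t) ((W i ω, V i ω), M i ω) : ℝ≥0∞)).toReal := by
    filter_upwards [hcoe] with ω hω s t j hst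
    have e : (Y t ω j : ℝ≥0∞) = Y s ω j +
        ∑' i, (jump j (Ioc s t) ((W i ω, V i ω), M i ω) : ℝ≥0∞) := by
      rw [hω, hω, ← ENNReal.tsum_add]
      exact tsum_congr fun i => by rw [jump_Iic_eq_add j hst, ENNReal.coe_add]
    have hfin : ∑' i, (jump j (Ioc s t) ((W i ω, V i ω), M i ω) : ℝ≥0∞) ≠ ∞ := fun h => by
      rw [h] at e
      simp at e
    have := congrArg ENNReal.toReal e
    rw [ENNReal.toReal_add (by simp) hfin, ENNReal.coe_toReal, ENNReal.coe_toReal] at this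
    linarith
  refine ⟨hν, hYm, ?_, ?_, ?_, ?_, ?_⟩
  · filter_upwards [hsum] with ω hω s t hst j
    refine Summable.tsum_le_tsum (fun i => ?_) (hω s j) (hω t j)
    gcongr
  · filter_upwards [hsum] with ω hω t
    exact continuousWithinAt_pi.2 fun j =>
      continuousWithinAt_tsum_indicator (a := fun i => M i ω j * W i ω) (fun t => hω t j) t
  · intro n t ht
    have hind := h.iIndepFun_tsum (κ := Fin n) (ι := Fin d)
      (f := fun k j q => jump j (Ioc (t k.castSucc) (t k.succ)) q)
      (fun k j => hj j measurableSet_Ioc) (fun k j v m => by simp [jump_zero])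
      (fun k l hkl q => ?_)
    · refine (hind.comp (fun _ x j => (x j).toReal) (fun _ => by fun_prop)).congr fun k => ?_
      filter_upwards [hincr] with ω hω
      ext j
      exact (hω _ _ j (ht (Fin.castSucc_lt_succ (i := k)).le)).symm
    -- The half-open intervals are disjoint, so a point contributes to at most one increment.
    · by_cases hk : q.1.2 ∈ Ioc (t k.castSucc) (t k.succ)
      · refine .inr fun j => ?_
        rw [jump_of_notMem j, ENNReal.coe_zero]
        intro hl
        rcases lt_or_gt_of_ne hkl with hlt | hlt
        · exact (hl.1.trans_le hk.2).not_ge (ht (Fin.succ_le_castSucc_iff.2 hlt))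
        · exact (hk.1.trans_le hl.2).not_ge (ht (Fin.succ_le_castSucc_iff.2 hlt))
      · exact .inl fun j => by rw [jump_of_notMem j hk, ENNReal.coe_zero]
  · refine IndepFun.indepFun_process (hYm 0) (fun t => ?_) fun I => ?_
    · have := hYm t
      have := hYm 0
      fun_prop
    -- Block `0` collects jumps at time `0`, block `1` those in `(0, t]` for the finitely many `t`
    -- in `I`. Both blocks need the same index type: `Y 0` is read at `none` and the increments at
    -- `some t`.
    · let f : Fin 2 → Option I × Fin d → (ℝ≥0 × ℝ≥0) × (Fin d → ℝ≥0) → ℝ≥0∞ := fun k p q =>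
        if k = 0 then jump p.2 (Iic 0) q
        else p.1.elim 0 fun t : I => (jump p.2 (Ioc 0 t.1) q : ℝ≥0∞)
      have hf : ∀ k p, Measurable (f k p) := by
        rintro k ⟨_ | t, j⟩ <;> by_cases hk : k = 0
        · simp only [f, hk, if_true]
          exact hj j measurableSet_Iic
        · simp only [f, hk, if_false, Option.elim]
          exact measurable_const
        · simp only [f, hk, if_true]
          exact hj j measurableSet_Iic
        · simp only [f, hk, if_false, Option.elim]
          exact hj j measurableSet_Ioc
      have hzero : ∀ q : (ℝ≥0 × ℝ≥0) × (Fin d → ℝ≥0),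
          (∀ p, f 0 p q = 0) ∨ ∀ p, f 1 p q = 0 := by
        intro q
        by_cases hq : q.1.2 ≤ 0
        · refine .inr ?_
          rintro ⟨_ | t, j⟩
          · simp [f]
          · simp [f, jump_of_notMem j (A := Ioc 0 t.1) (fun h => h.1.not_ge hq)]
        · exact .inl fun p => by simp [f, jump_of_notMem p.2 (A := Iic 0) hq]
      have hind := h.iIndepFun_tsum (f := f) hf (fun k p v m => ?_) (fun k l hkl q => ?_)
      · have h01 := hind.indepFun (i := 0) (j := 1) (by simp)
        refine (h01.comp (φ := fun (x : Option I × Fin d → ℝ≥0∞) j => (x (none, j)).toNNReal)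
          (ψ := fun (x : Option I × Fin d → ℝ≥0∞) (t : I) j => (x (some t, j)).toReal)
          (by fun_prop) (by fun_prop)).congr ?_ ?_
        · filter_upwards [hcoe] with ω hω
          ext j
          simp [f, ← hω]
        · filter_upwards [hincr] with ω hω
          ext t j
          simp [f, hω 0 t j zero_le]
      · rcases p with ⟨_ | t, j⟩ <;> simp [f, jump_zero]
      · fin_cases k <;> fin_cases l
        · exact absurd rfl hkl
        · exact hzero q
        · exact (hzero q).symm
        · exact absurd rfl hkl
  · intro t l
    have e1 : ∀ ω, -∑ j, (l j : ℝ) * Y t ω j = -((∑ j, l j * Y t ω j : ℝ≥0) : ℝ) := fun ω => by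
      push_cast
      rfl
    have e2 : ∀ p : (Fin d → ℝ≥0) × ℝ≥0, -∑ j, (l j : ℝ) * p.1 j =
        -((∑ j, l j * p.1 j : ℝ≥0) : ℝ) := fun p => by
      push_cast
      rfl
    simp_rw [e1, e2]
    have := hYm t
    rw [integral_exp_neg_eq_toReal (by fun_prop), integral_one_sub_exp_neg_eq_toReal (by fun_prop)]
    have e3 : ∫⁻ ω, expNeg ((∑ j, l j * Y t ω j : ℝ≥0) : ℝ≥0∞) ∂P =
        ∫⁻ ω, expNeg (∑ j, l j * ∑' i, (jump j (Iic t) ((W i ω, V i ω), M i ω) : ℝ≥0∞)) ∂P := by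
      refine lintegral_congr_ae ?_
      filter_upwards [hcoe] with ω hω
      push_cast
      simp_rw [hω]
    rw [e3, h.lintegral_expNeg_jump, expNeg_eq_ofReal
      (hν.lintegral_one_sub_expNeg_lt_top t l).ne, ENNReal.toReal_ofReal (Real.exp_nonneg _)]

end SubordinatorVector

/-! ### The compound intensity as an image of a product measure. -/

section Intensities

lemma measurableEmbedding_coe_orthant (d : ℕ) :
    MeasurableEmbedding fun (s : Fin d → ℝ≥0) (j : Fin d) => (s j : ℝ) :=
  Continuous.measurableEmbedding (by fun_prop) fun s t h => by
    ext j
    exact congrFun h j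

/-- Needed for Tonelli. Orthant volume is an image of restricted Lebesgue measure, and s-finiteness
survives restriction and pushforward. -/
instance (d : ℕ) : SFinite (orthantVolume d) := by
  have he := measurableEmbedding_coe_orthant d
  have hg : Measurable fun (x : Fin d → ℝ) (j : Fin d) => (x j).toNNReal := by fun_prop
  have : orthantVolume d = ((volume : Measure (Fin d → ℝ)).restrict
      (range fun (s : Fin d → ℝ≥0) (j : Fin d) => (s j : ℝ))).map
        fun (x : Fin d → ℝ) (j : Fin d) => (x j).toNNReal := by
    rw [← he.map_comap, Measure.map_map hg he.measurable, orthantVolume]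
    conv_lhs => rw [← Measure.map_id (μ := Measure.comap _ _)]
    congr 1
    ext s j
    simp
  rw [this]
  infer_instance

open scoped Pointwise in
lemma map_mul_orthantVolume (d : ℕ) {z : ℝ≥0} (hz : z ≠ 0) :
    (orthantVolume d).map (fun s j => s j * z) = ((z⁻¹ ^ d : ℝ≥0) : ℝ≥0∞) • orthantVolume d := by
  have he := measurableEmbedding_coe_orthant d
  ext A hA
  rw [Measure.map_apply (by fun_prop) hA, Measure.smul_apply, orthantVolume, he.comap_apply,
    he.comap_apply, smul_eq_mul]
  have e : (fun (s : Fin d → ℝ≥0) (j : Fin d) => (s j : ℝ)) ''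
      ((fun (s : Fin d → ℝ≥0) (j : Fin d) => s j * z) ⁻¹' A) =
      ((z⁻¹ : ℝ≥0) : ℝ) • ((fun (s : Fin d → ℝ≥0) (j : Fin d) => (s j : ℝ)) '' A) := by
    ext x
    simp only [mem_image, mem_preimage, mem_smul_set]
    constructor
    · rintro ⟨s, hs, rfl⟩
      refine ⟨_, ⟨_, hs, rfl⟩, ?_⟩
      ext j
      simp only [Pi.smul_apply, smul_eq_mul, ← NNReal.coe_mul]
      rw [mul_comm (s j), inv_mul_cancel_left₀ hz]
    · rintro ⟨_, ⟨s, hs, rfl⟩, rfl⟩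
      refine ⟨fun j => z⁻¹ * s j, ?_, ?_⟩
      · convert hs using 2 with j
        rw [mul_comm, mul_inv_cancel_left₀ hz]
      · ext j
        simp
  rw [e, Measure.addHaar_smul_of_nonneg _ (by positivity), Module.finrank_fin_fun,
    ← NNReal.coe_pow, ENNReal.ofReal_coe_nnreal]

variable {d : ℕ} {h : (Fin d → ℝ≥0) → ℝ≥0}

lemma IsScoreDensity.isProbabilityMeasure (hh : IsScoreDensity h) :
    IsProbabilityMeasure (scoreLaw h) :=
  ⟨by rw [scoreLaw, withDensity_apply _ MeasurableSet.univ, Measure.restrict_univ,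
    hh.lintegral_eq_one]⟩

/-- The jumps of a compound vector of subordinators are those of the directing measure, multiplied
by independent scores. -/
theorem compoundIntensity_eq_markedIntensity (hh : IsScoreDensity h)
    {ν : Measure (ℝ≥0 × ℝ≥0)} (hν : ν {p | p.1 = 0} = 0) :
    compoundIntensity h ν = markedIntensity ν (scoreLaw h) := by
  have hm := hh.measurable
  have := hh.isProbabilityMeasure
  have hdens : Measurable fun q : (ℝ≥0 × ℝ≥0) × (Fin d → ℝ≥0) =>
      ((q.1.1⁻¹ ^ d * h (fun j => q.2 j / q.1.1) : ℝ≥0) : ℝ≥0∞) := by fun_prop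
  ext B hB
  have hB1 : MeasurableSet ((fun q : (ℝ≥0 × ℝ≥0) × (Fin d → ℝ≥0) => (q.2, q.1.2)) ⁻¹' B) :=
    (by fun_prop : Measurable fun q : (ℝ≥0 × ℝ≥0) × (Fin d → ℝ≥0) => (q.2, q.1.2)) hB
  have hmB : Measurable fun q : (ℝ≥0 × ℝ≥0) × (Fin d → ℝ≥0) =>
      ((fun j => q.2 j * q.1.1, q.1.2) : (Fin d → ℝ≥0) × ℝ≥0) := by fun_prop
  have hB2 := hmB hB
  have hI : Measurable (B.indicator (1 : (Fin d → ℝ≥0) × ℝ≥0 → ℝ≥0∞)) :=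
    measurable_one.indicator hB
  rw [compoundIntensity, Measure.map_apply (by fun_prop) hB, withDensity_apply _ hB1,
    ← lintegral_indicator hB1, lintegral_prod _ (hdens.indicator hB1).aemeasurable,
    markedIntensity, Measure.map_apply hmB hB, ← lintegral_indicator_one hB2,
    lintegral_prod _ (measurable_one.indicator hB2).aemeasurable]
  refine lintegral_congr_ae ?_
  have hae : ∀ᵐ p ∂ν, p.1 ≠ 0 := by
    rw [ae_iff]
    simpa using hν
  filter_upwards [hae] with p hp
  have hI' : Measurable fun s : Fin d → ℝ≥0 => B.indicator (1 : (Fin d → ℝ≥0) × ℝ≥0 → ℝ≥0∞) (s, p.2) :=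
    hI.comp measurable_prodMk_right
  have hG : Measurable fun s : Fin d → ℝ≥0 =>
      (h (fun j => s j / p.1) : ℝ≥0∞) * B.indicator 1 (s, p.2) := by fun_prop
  calc ∫⁻ s, ((fun q : (ℝ≥0 × ℝ≥0) × (Fin d → ℝ≥0) => (q.2, q.1.2)) ⁻¹' B).indicator
        (fun q => ((q.1.1⁻¹ ^ d * h (fun j => q.2 j / q.1.1) : ℝ≥0) : ℝ≥0∞)) (p, s)
        ∂orthantVolume d
      = ∫⁻ s, ((p.1⁻¹ ^ d : ℝ≥0) : ℝ≥0∞) *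
          ((h (fun j => s j / p.1) : ℝ≥0∞) * B.indicator 1 (s, p.2)) ∂orthantVolume d := by
        refine lintegral_congr fun s => ?_
        by_cases hs : (s, p.2) ∈ B
        · rw [indicator_of_mem (by exact hs), indicator_of_mem hs]
          simp
        · rw [indicator_of_notMem (by exact hs), indicator_of_notMem hs]
          simp
    -- Substitution `s = z m` with `z = p.1`; the factor `z^{-d}` is absorbed as the Jacobian by
    -- `map_mul_orthantVolume`.
    _ = ∫⁻ m, (h m : ℝ≥0∞) * B.indicator 1 ((fun j => m j * p.1), p.2) ∂orthantVolume d := by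
        rw [lintegral_const_mul _ hG, ← smul_eq_mul, ← lintegral_smul_measure,
          ← map_mul_orthantVolume d hp, lintegral_map hG (by fun_prop)]
        simp_rw [mul_div_cancel_right₀ _ hp]
    _ = _ := by
        have hK : Measurable fun m : Fin d → ℝ≥0 =>
            ((fun q : (ℝ≥0 × ℝ≥0) × (Fin d → ℝ≥0) =>
              ((fun j => q.2 j * q.1.1, q.1.2) : (Fin d → ℝ≥0) × ℝ≥0)) ⁻¹' B).indicator
              (1 : (ℝ≥0 × ℝ≥0) × (Fin d → ℝ≥0) → ℝ≥0∞) (p, m) :=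
          (measurable_one.indicator hB2).comp measurable_prodMk_left
        rw [scoreLaw, lintegral_withDensity_eq_lintegral_mul _ (by fun_prop) hK]
        rfl

lemma IsUnivariateLevyIntensity.null_zero {ν : Measure (ℝ≥0 × ℝ≥0)}
    (hν : IsUnivariateLevyIntensity ν) : ν {p | p.1 = 0} = 0 := by
  have h0 := IsLevyIntensity.null_zero hν
  have hm : MeasurableSet {p : (Fin 1 → ℝ≥0) × ℝ≥0 | p.1 = 0} :=
    measurable_fst (measurableSet_singleton 0)
  rw [oneVariate, Measure.map_apply (by fun_prop) hm] at h0
  convert h0 using 2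
  ext p
  simp [funext_iff]

/-- By Markov's inequality the sets `min 1 z ≥ 1 / (n + 1)`, `x ≤ n` have finite measure; with the
null set `z = 0` they cover the space. -/
lemma IsUnivariateLevyIntensity.sigmaFinite {ν : Measure (ℝ≥0 × ℝ≥0)}
    (hν : IsUnivariateLevyIntensity ν) : SigmaFinite ν := by
  have hint : ∀ T : ℝ≥0, ∫⁻ p in {p | p.2 ≤ T}, ((min 1 p.1 : ℝ≥0) : ℝ≥0∞) ∂ν < ∞ := by
    intro T
    have hi := IsLevyIntensity.integrable hν T
    have hT : MeasurableSet {p : (Fin 1 → ℝ≥0) × ℝ≥0 | p.2 ≤ T} :=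
      measurableSet_le measurable_snd measurable_const
    rw [oneVariate, setLIntegral_map hT (by fun_prop) (by fun_prop)] at hi
    simpa using hi
  let A : ℕ → Set (ℝ≥0 × ℝ≥0) := fun n =>
    {p | p.1 = 0} ∪ ({p | ((1 / ((n : ℝ≥0) + 1) : ℝ≥0) : ℝ≥0∞) ≤ ((min 1 p.1 : ℝ≥0) : ℝ≥0∞)} ∩
      {p | p.2 ≤ n})
  refine Measure.sigmaFinite_of_countable (countable_range A) ?_ ?_
  · rintro _ ⟨n, rfl⟩
    refine (measure_union_le _ _).trans_lt ?_
    rw [hν.null_zero, zero_add]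
    have hn : MeasurableSet {p : ℝ≥0 × ℝ≥0 | p.2 ≤ n} :=
      measurableSet_le measurable_snd measurable_const
    rw [← Measure.restrict_apply' hn]
    refine (meas_ge_le_lintegral_div (by fun_prop) (by simp) ENNReal.coe_ne_top).trans_lt ?_
    exact ENNReal.div_lt_top (hint n).ne (by simp)
  · refine eq_univ_of_forall fun p => ?_
    by_cases hp : p.1 = 0
    · exact ⟨A 0, ⟨0, rfl⟩, .inl hp⟩
    · have hpos : 0 < min 1 p.1 := lt_min one_pos (pos_iff_ne_zero.2 hp)
      obtain ⟨m, hm⟩ := exists_nat_ge p.2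
      obtain ⟨n, hn⟩ := exists_nat_one_div_lt hpos
      refine ⟨A (max m n), ⟨_, rfl⟩, .inr ⟨?_, ?_⟩⟩
      · refine ENNReal.coe_le_coe.2 (le_trans ?_ hn.le)
        gcongr
        exact le_max_right _ _
      · exact hm.trans (by exact_mod_cast le_max_left m n)

lemma markedIntensity_dirac_one (ν : Measure (ℝ≥0 × ℝ≥0)) [SFinite ν] :
    markedIntensity ν (.dirac (fun _ : Fin 1 => 1)) = oneVariate ν := by
  rw [markedIntensity, Measure.prod_dirac, Measure.map_map (by fun_prop) (by fun_prop), oneVariate]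
  congr 1
  ext p <;> simp

end Intensities

/-! ### The Lévy intensity determines the law of the process. -/

section LawUniqueness

/-- The increment of `Y` from `s` to `t`, with values in the orthant. -/
noncomputable def increment {Ω : Type*} {d : ℕ} (Y : ℝ≥0 → Ω → Fin d → ℝ≥0) (s t : ℝ≥0) (ω : Ω)
    (j : Fin d) : ℝ≥0 :=
  ((Y t ω j : ℝ) - Y s ω j).toNNReal

variable {Ω : Type*} [MeasurableSpace Ω] {P : Measure Ω} [IsProbabilityMeasure P] {d : ℕ}
  {ν : Measure ((Fin d → ℝ≥0) × ℝ≥0)} {Y : ℝ≥0 → Ω → Fin d → ℝ≥0}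

omit [IsProbabilityMeasure P] in
lemma IsSubordinatorVector.measurable_increment (h : IsSubordinatorVector P ν Y) (s t : ℝ≥0) :
    Measurable (increment Y s t) := by
  have := h.measurable s
  have := h.measurable t
  unfold increment
  fun_prop

-- Monotone paths make the truncation in `increment` harmless.
omit [IsProbabilityMeasure P] in
lemma IsSubordinatorVector.ae_add_increment (h : IsSubordinatorVector P ν Y) :
    ∀ᵐ ω ∂P, ∀ s t : ℝ≥0, s ≤ t → ∀ j, Y t ω j = Y s ω j + increment Y s t ω j := by
  filter_upwards [h.monotone] with ω hω s t hst j
  have hle : Y s ω j ≤ Y t ω j := hω hst j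
  have : (0 : ℝ) ≤ (Y t ω j : ℝ) - Y s ω j := sub_nonneg.2 (by exact_mod_cast hle)
  rw [← NNReal.coe_inj, NNReal.coe_add, increment, Real.coe_toNNReal _ this]
  ring

lemma IsSubordinatorVector.lintegral_expNeg (h : IsSubordinatorVector P ν Y) (t : ℝ≥0)
    (l : Fin d → ℝ≥0) :
    ∫⁻ ω, expNeg ((∑ j, l j * Y t ω j : ℝ≥0) : ℝ≥0∞) ∂P = ENNReal.ofReal
      (Real.exp (-∫ p in {p | p.2 ≤ t}, (1 - Real.exp (-∑ j, (l j : ℝ) * p.1 j)) ∂ν)) := by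
  have := h.measurable t
  have hle : ∫⁻ ω, expNeg ((∑ j, l j * Y t ω j : ℝ≥0) : ℝ≥0∞) ∂P ≤ 1 :=
    calc _ ≤ ∫⁻ _, 1 ∂P := lintegral_mono fun _ => expNeg_le_one _
      _ = 1 := by simp
  rw [← h.laplace t l, ← ENNReal.ofReal_toReal (hle.trans_lt (by simp)).ne,
    ← integral_exp_neg_eq_toReal (by fun_prop)]
  push_cast
  rfl

-- `Y t` splits into the independent pieces `Y 0`, `Y s - Y 0` and `Y t - Y s`. This gives access to
-- the law of an increment, while the definition prescribes only laws at fixed times.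
omit [IsProbabilityMeasure P] in
lemma IsSubordinatorVector.lintegral_expNeg_mul_increment (h : IsSubordinatorVector P ν Y)
    {s t : ℝ≥0} (hst : s ≤ t) (l : Fin d → ℝ≥0) :
    ∫⁻ ω, expNeg ((∑ j, l j * Y t ω j : ℝ≥0) : ℝ≥0∞) ∂P =
      (∫⁻ ω, expNeg ((∑ j, l j * Y s ω j : ℝ≥0) : ℝ≥0∞) ∂P) *
        ∫⁻ ω, expNeg ((∑ j, l j * increment Y s t ω j : ℝ≥0) : ℝ≥0∞) ∂P := by
  have hincr := h.measurable_increment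
  have hY0 := h.measurable 0
  have h0 : ∀ u, ∫⁻ ω, expNeg ((∑ j, l j * Y u ω j : ℝ≥0) : ℝ≥0∞) ∂P =
      (∫⁻ ω, expNeg ((∑ j, l j * Y 0 ω j : ℝ≥0) : ℝ≥0∞) ∂P) *
        ∫⁻ ω, expNeg ((∑ j, l j * increment Y 0 u ω j : ℝ≥0) : ℝ≥0∞) ∂P := by
    intro u
    have hu := hincr 0 u
    rw [← lintegral_mul_eq_lintegral_mul_lintegral_of_indepFun (by fun_prop) (by fun_prop)]
    · refine lintegral_congr_ae ?_
      filter_upwards [h.ae_add_increment] with ω hω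
      simp_rw [hω 0 u zero_le]
      rw [Pi.mul_apply, ← expNeg_add, ← ENNReal.coe_add, ← Finset.sum_add_distrib]
      simp_rw [mul_add]
    · exact h.indep_initial.comp
        (φ := fun y : Fin d → ℝ≥0 => expNeg ((∑ j, l j * y j : ℝ≥0) : ℝ≥0∞))
        (ψ := fun z : ℝ≥0 → Fin d → ℝ => expNeg ((∑ j, l j * (z u j).toNNReal : ℝ≥0) : ℝ≥0∞))
        (by fun_prop) (by fun_prop)
  have h1 : ∫⁻ ω, expNeg ((∑ j, l j * increment Y 0 t ω j : ℝ≥0) : ℝ≥0∞) ∂P =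
      (∫⁻ ω, expNeg ((∑ j, l j * increment Y 0 s ω j : ℝ≥0) : ℝ≥0∞) ∂P) *
        ∫⁻ ω, expNeg ((∑ j, l j * increment Y s t ω j : ℝ≥0) : ℝ≥0∞) ∂P := by
    have hs := hincr 0 s
    have ht := hincr s t
    rw [← lintegral_mul_eq_lintegral_mul_lintegral_of_indepFun (by fun_prop) (by fun_prop)]
    · refine lintegral_congr_ae ?_
      filter_upwards [h.ae_add_increment] with ω hω
      have e : ∀ j, increment Y 0 t ω j = increment Y 0 s ω j + increment Y s t ω j := by
        intro j
        have e1 := hω 0 t zero_le j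
        rw [hω s t hst j, hω 0 s zero_le j, add_assoc] at e1
        exact (add_left_cancel e1).symm
      simp_rw [e]
      rw [Pi.mul_apply, ← expNeg_add, ← ENNReal.coe_add, ← Finset.sum_add_distrib]
      simp_rw [mul_add]
    · exact (h.indep_increments.indepFun_sub_sub zero_le hst).comp
        (φ := fun z : Fin d → ℝ => expNeg ((∑ j, l j * (z j).toNNReal : ℝ≥0) : ℝ≥0∞))
        (ψ := fun z : Fin d → ℝ => expNeg ((∑ j, l j * (z j).toNNReal : ℝ≥0) : ℝ≥0∞))
        (by fun_prop) (by fun_prop)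
  rw [h0 t, h0 s, h1, mul_assoc]

variable {Ω' : Type*} [MeasurableSpace Ω'] {P' : Measure Ω'} [IsProbabilityMeasure P']
  {Y' : ℝ≥0 → Ω' → Fin d → ℝ≥0}

lemma IsSubordinatorVector.map_eq (h : IsSubordinatorVector P ν Y)
    (h' : IsSubordinatorVector P' ν Y') (t : ℝ≥0) : P.map (Y t) = P'.map (Y' t) := by
  have := Measure.isProbabilityMeasure_map (μ := P) (h.measurable t).aemeasurable
  have := Measure.isProbabilityMeasure_map (μ := P') (h'.measurable t).aemeasurable
  refine ext_of_lintegral_expNeg fun l => ?_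
  rw [lintegral_map (by fun_prop) (h.measurable t), lintegral_map (by fun_prop) (h'.measurable t),
    h.lintegral_expNeg, h'.lintegral_expNeg]

/-- The Laplace transform at time `s` is positive and finite, so it cancels from the factorization.
-/
lemma IsSubordinatorVector.map_increment_eq (h : IsSubordinatorVector P ν Y)
    (h' : IsSubordinatorVector P' ν Y') {s t : ℝ≥0} (hst : s ≤ t) :
    P.map (increment Y s t) = P'.map (increment Y' s t) := by
  have hm := h.measurable_increment s t
  have hm' := h'.measurable_increment s t
  have := Measure.isProbabilityMeasure_map (μ := P) hm.aemeasurable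
  have := Measure.isProbabilityMeasure_map (μ := P') hm'.aemeasurable
  refine ext_of_lintegral_expNeg fun l => ?_
  rw [lintegral_map (by fun_prop) hm, lintegral_map (by fun_prop) hm']
  have e := h.lintegral_expNeg_mul_increment hst l
  have e' := h'.lintegral_expNeg_mul_increment hst l
  rw [h.lintegral_expNeg, h.lintegral_expNeg] at e
  rw [h'.lintegral_expNeg, h'.lintegral_expNeg, e] at e'
  exact (ENNReal.mul_right_inj (by simpa using Real.exp_pos _) ENNReal.ofReal_ne_top).1 e'

lemma IsSubordinatorVector.map_increments (h : IsSubordinatorVector P ν Y) {t : ℕ → ℝ≥0}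
    (ht : Monotone t) :
    P.map (fun ω => (Y 0 ω, fun k => increment Y (t k) (t (k + 1)) ω)) =
      (P.map (Y 0)).prod (Measure.infinitePi fun k => P.map (increment Y (t k) (t (k + 1)))) := by
  have hincr := h.measurable_increment
  have hm : Measurable fun ω k => increment Y (t k) (t (k + 1)) ω :=
    measurable_pi_lambda _ fun k => hincr _ _
  rw [IndepFun.map_prod_eq_prod_map_map (h.measurable 0).aemeasurable hm.aemeasurable,
    iIndepFun.map_fun_eq_infinitePi_map (fun k => hincr _ _)]
  · exact (h.indep_increments.nat ht).comp (fun _ (z : Fin d → ℝ) j => (z j).toNNReal)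
      (fun _ => by fun_prop)
  · have := h.indep_initial.comp (φ := id)
      (ψ := fun (z : ℝ≥0 → Fin d → ℝ) (k : ℕ) (j : Fin d) =>
        (z (t (k + 1)) j - z (t k) j).toNNReal) measurable_id (by fun_prop)
    have e : (fun ω k => increment Y (t k) (t (k + 1)) ω) =
        (fun (z : ℝ≥0 → Fin d → ℝ) (k : ℕ) (j : Fin d) =>
          (z (t (k + 1)) j - z (t k) j).toNNReal) ∘
        fun ω (t : ℝ≥0) (j : Fin d) => (Y t ω j : ℝ) - Y 0 ω j := by
      ext ω k j
      simp [increment]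
    rw [e]
    exact this

lemma IsSubordinatorVector.map_monotone (h : IsSubordinatorVector P ν Y) {t : ℕ → ℝ≥0}
    (ht : Monotone t) (ht0 : t 0 = 0) :
    P.map (fun ω n => Y (t n) ω) = ((P.map (Y 0)).prod
      (Measure.infinitePi fun k => P.map (increment Y (t k) (t (k + 1))))).map
        fun p n j => p.1 j + ∑ k ∈ Finset.range n, p.2 k j := by
  rw [← h.map_increments ht, Measure.map_map (by fun_prop) ((h.measurable 0).prodMk
    (measurable_pi_lambda _ fun k => h.measurable_increment _ _))]
  refine Measure.map_congr ?_
  filter_upwards [h.ae_add_increment] with ω hω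
  ext n j
  simp only [Function.comp_apply, NNReal.coe_inj]
  induction n with
  | zero => simp [ht0]
  | succ n ih =>
    rw [Finset.sum_range_succ, ← add_assoc, ← ih]
    exact hω _ _ (ht n.le_succ) j

lemma IsSubordinatorVector.map_monotone_eq (h : IsSubordinatorVector P ν Y)
    (h' : IsSubordinatorVector P' ν Y') {t : ℕ → ℝ≥0} (ht : Monotone t) (ht0 : t 0 = 0) :
    P.map (fun ω n => Y (t n) ω) = P'.map (fun ω n => Y' (t n) ω) := by
  rw [h.map_monotone ht ht0, h'.map_monotone ht ht0, h.map_eq h' 0]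
  simp_rw [h.map_increment_eq h' (ht (Nat.le_succ _))]

/-- Puts finitely many times into the form used by `map_monotone_eq`: a nondecreasing sequence
started at `0`. -/
lemma exists_monotone_seq (s : Finset ℝ≥0) :
    ∃ t : ℕ → ℝ≥0, Monotone t ∧ t 0 = 0 ∧ ∀ x ∈ s, ∃ n, t n = x := by
  let J := insert 0 s
  have hJ : 0 < J.card := Finset.card_pos.2 ⟨0, Finset.mem_insert_self 0 s⟩
  -- Capping the index repeats the largest point forever.
  let e : ℕ → ℝ≥0 := fun n => J.orderEmbOfFin rfl ⟨min n (J.card - 1), by omega⟩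
  have he : Monotone e := fun m n hmn =>
    (J.orderEmbOfFin rfl).monotone (Fin.mk_le_mk.2 (min_le_min_right _ hmn))
  -- An extra `0` in front makes `t 0 = 0` definitional, so the `k`-th point of `J` sits at index `k
  -- + 1`.
  refine ⟨fun n => n.casesOn 0 e, monotone_nat_of_le_succ fun n => ?_, rfl, fun x hx => ?_⟩
  · cases n with
    | zero => exact zero_le
    | succ n => exact he n.le_succ
  · have : x ∈ Set.range (J.orderEmbOfFin rfl) := by
      rw [Finset.range_orderEmbOfFin]
      exact Finset.mem_insert_of_mem hx
    obtain ⟨k, hk⟩ := this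
    refine ⟨k + 1, ?_⟩
    rw [← hk]
    simp only [e]
    congr 1
    ext
    simp only
    omega

/-- The law of a vector of subordinators is determined by its Lévy intensity. -/
theorem IsSubordinatorVector.map_seq_eq (h : IsSubordinatorVector P ν Y)
    (h' : IsSubordinatorVector P' ν Y') (q : ℕ → ℝ≥0) :
    P.map (fun ω n => Y (q n) ω) = P'.map (fun ω n => Y' (q n) ω) := by
  have hm : Measurable fun ω n => Y (q n) ω := measurable_pi_lambda _ fun n => h.measurable _
  have hm' : Measurable fun ω n => Y' (q n) ω := measurable_pi_lambda _ fun n => h'.measurable _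
  have : ∀ I : Finset ℕ, IsFiniteMeasure (P.map fun ω => I.restrict fun n => Y (q n) ω) :=
    fun I => inferInstance
  -- Laws of sequences are determined by their finite-dimensional marginals.
  refine IsProjectiveLimit.unique
    (isProjectiveLimit_map (X := fun n ω => Y (q n) ω) hm.aemeasurable) fun I => ?_
  rw [isProjectiveLimit_map (X := fun n ω => Y' (q n) ω) hm'.aemeasurable I]
  change P'.map (fun ω => I.restrict fun n => Y' (q n) ω) =
    P.map (fun ω => I.restrict fun n => Y (q n) ω)
  obtain ⟨t, ht, ht0, htI⟩ := exists_monotone_seq (I.image q)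
  choose n hn using fun i : I => htI (q i) (Finset.mem_image_of_mem q i.2)
  let g : (ℕ → Fin d → ℝ≥0) → I → Fin d → ℝ≥0 := fun x i => x (n i)
  have hg : Measurable g := by fun_prop
  have e : (fun ω => I.restrict fun n => Y (q n) ω) = g ∘ fun ω k => Y (t k) ω := by
    ext ω i j
    simp [g, hn]
  have e' : (fun ω => I.restrict fun n => Y' (q n) ω) = g ∘ fun ω k => Y' (t k) ω := by
    ext ω i j
    simp [g, hn]
  rw [e, e', ← Measure.map_map hg (measurable_pi_lambda _ fun n => h.measurable _),
    ← Measure.map_map hg (measurable_pi_lambda _ fun n => h'.measurable _),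
    h.map_monotone_eq h' ht ht0]

end LawUniqueness

/-! ### Coupling through a conditional distribution. -/

section Extension

/-- Transfer: if `y` and `y₂` have the same law, the space of `y` has an extension that carries a
point of the space of `y₂` with `y₂ = y` almost surely. -/
theorem exists_extension {Ω : Type u} [MeasurableSpace Ω] (P : Measure Ω) [IsProbabilityMeasure P]
    {S : Type} [MeasurableSpace S] {Ω₂ : Type} [MeasurableSpace Ω₂] [StandardBorelSpace Ω₂]
    [Nonempty Ω₂] (Q : Measure Ω₂) [IsProbabilityMeasure Q] {y : Ω → S} {y₂ : Ω₂ → S}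
    (hy : Measurable y) (hy₂ : Measurable y₂) (hlaw : P.map y = Q.map y₂) :
    ∃ (Ω' : Type u) (_ : MeasurableSpace Ω') (P' : Measure Ω') (_ : IsProbabilityMeasure P')
      (π : Ω' → Ω) (τ : Ω' → Ω₂), MeasurePreserving π P' P ∧ MeasurePreserving τ P' Q ∧
      P'.map (fun ω => (y (π ω), τ ω)) = Q.map fun ω => (y₂ ω, ω) := by
  -- `κ` is the conditional law of the point of `Ω₂` given the value of `y₂`, available because `Ω₂`
  -- is standard Borel. The extension samples it at the value `y ω`.
  let κ : Kernel S Ω₂ := condDistrib id y₂ Q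
  let P' : Measure (Ω × Ω₂) := P ⊗ₘ κ.comap y hy
  have hjoint : P'.map (fun ω => (y ω.1, ω.2)) = Q.map fun ω => (y₂ ω, ω) := by
    have e : (Q.map y₂) ⊗ₘ κ = Q.map fun ω => (y₂ ω, id ω) :=
      compProd_map_condDistrib (X := y₂) (Y := id) (μ := Q) aemeasurable_id
    simp only [id] at e
    rw [← e, ← hlaw]
    ext s hs
    have hm : Measurable fun ω : Ω × Ω₂ => (y ω.1, ω.2) := by fun_prop
    rw [Measure.map_apply hm hs, Measure.compProd_apply (hm hs), Measure.compProd_apply hs,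
      lintegral_map (Kernel.measurable_kernel_prodMk_left hs) hy]
    rfl
  refine ⟨Ω × Ω₂, inferInstance, P', inferInstance, Prod.fst, Prod.snd,
    ⟨measurable_fst, Measure.fst_compProd _ _⟩, ⟨measurable_snd, ?_⟩, hjoint⟩
  have := congrArg (Measure.map Prod.snd) hjoint
  rw [Measure.map_map measurable_snd (by fun_prop),
    Measure.map_map measurable_snd (by fun_prop)] at this
  exact this.trans Measure.map_id

end Extension

/-! ### Pulling structures back along measure-preserving maps. -/

section MeasurePreserving

variable {Ω Ω' : Type*} [MeasurableSpace Ω] [MeasurableSpace Ω'] {P : Measure Ω} {P' : Measure Ω'}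
  [IsProbabilityMeasure P] [IsProbabilityMeasure P'] {τ : Ω' → Ω}

lemma iIndepFun_comp_measurePreserving {ι E : Type*} [MeasurableSpace E] {f : ι → Ω → E}
    (hf : ∀ i, Measurable (f i)) (h : iIndepFun f P) (hτ : MeasurePreserving τ P' P) :
    iIndepFun (fun i ω => f i (τ ω)) P' := by
  rw [iIndepFun_iff_map_fun_eq_infinitePi_map (X := fun i ω => f i (τ ω))
    fun i => (hf i).comp hτ.measurable]
  rw [iIndepFun_iff_map_fun_eq_infinitePi_map hf, ← hτ.map_eq,
    Measure.map_map (measurable_pi_lambda _ hf) hτ.measurable] at h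
  simp_rw [Measure.map_map (hf _) hτ.measurable] at h
  exact h

lemma indepFun_comp_measurePreserving {E F : Type*} [MeasurableSpace E] [MeasurableSpace F]
    {f : Ω → E} {g : Ω → F} (hf : Measurable f) (hg : Measurable g) (h : IndepFun f g P)
    (hτ : MeasurePreserving τ P' P) :
    IndepFun (fun ω => f (τ ω)) (fun ω => g (τ ω)) P' := by
  rw [indepFun_iff_map_prod_eq_prod_map_map (f := fun ω => f (τ ω)) (g := fun ω => g (τ ω))
    (hf.comp hτ.measurable).aemeasurable
    (hg.comp hτ.measurable).aemeasurable]
  rw [indepFun_iff_map_prod_eq_prod_map_map hf.aemeasurable hg.aemeasurable, ← hτ.map_eq,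
    Measure.map_map (hf.prodMk hg) hτ.measurable, Measure.map_map hf hτ.measurable,
    Measure.map_map hg hτ.measurable] at h
  exact h

lemma IsPoissonRandomMeasure.comp_measurePreserving {E : Type*} [MeasurableSpace E] {μ : Measure E}
    {N : Ω → Measure E} (h : IsPoissonRandomMeasure P μ N) (hτ : MeasurePreserving τ P' P) :
    IsPoissonRandomMeasure P' μ fun ω => N (τ ω) where
  measurable B hB := (h.measurable B hB).comp hτ.measurable
  law B hB hμ := by
    rw [← h.law B hB hμ, ← hτ.map_eq, Measure.map_map (h.measurable B hB) hτ.measurable]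
    rfl
  eq_top B hB hμ := hτ.quasiMeasurePreserving.ae (h.eq_top B hB hμ)
  indep n B hB hd := iIndepFun_comp_measurePreserving (fun k => h.measurable _ (hB k))
    (h.indep n B hB hd) hτ

variable {d : ℕ} {ν : Measure (ℝ≥0 × ℝ≥0)} {ρ : Measure (Fin d → ℝ≥0)} {W V : ℕ → Ω → ℝ≥0}
  {M : ℕ → Ω → Fin d → ℝ≥0}

lemma IsMarkedPoisson.comp_measurePreserving (h : IsMarkedPoisson P ν ρ W V M)
    (hτ : MeasurePreserving τ P' P) :
    IsMarkedPoisson P' ν ρ (fun i ω => W i (τ ω)) (fun i ω => V i (τ ω)) fun i ω => M i (τ ω) where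
  measurable_weight i := (h.measurable_weight i).comp hτ.measurable
  measurable_time i := (h.measurable_time i).comp hτ.measurable
  poisson := h.poisson.comp_measurePreserving hτ
  measurable_mark i := (h.measurable_mark i).comp hτ.measurable
  law i := by
    rw [← h.law i, ← hτ.map_eq, Measure.map_map (h.measurable_mark i) hτ.measurable]
    rfl
  iIndep := iIndepFun_comp_measurePreserving h.measurable_mark h.iIndep hτ
  indep := indepFun_comp_measurePreserving (measurable_pi_lambda _ h.measurable_mark)
    (measurable_pi_lambda _ fun i => (h.measurable_weight i).prodMk (h.measurable_time i))
    h.indep hτ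

/-- With the mark `1` in dimension one, the marked series is the directing subordinator itself. -/
lemma IsMarkedPoisson.const_mark (h : IsMarkedPoisson P ν ρ W V M)
    {e : ℕ} (m : Fin e → ℝ≥0) :
    IsMarkedPoisson P ν (.dirac m) W V fun _ _ => m where
  measurable_weight := h.measurable_weight
  measurable_time := h.measurable_time
  poisson := h.poisson
  measurable_mark _ := measurable_const
  law _ := by simp [Measure.map_const]
  iIndep := h.iIndep.comp (fun _ _ => m) fun _ => measurable_const
  indep := h.indep.comp (φ := fun _ _ => m) (ψ := id) measurable_const measurable_id

end MeasurePreserving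

/-! ### A marked Poisson process on a standard Borel space. -/

section Existence

instance : StandardBorelSpace PointSpace :=
  inferInstanceAs (StandardBorelSpace (ℕ → ℕ × (ℕ → ℝ≥0 × ℝ≥0)))

/-- A marked Poisson process with given intensity and mark law exists on a standard Borel space. -/
theorem exists_isMarkedPoisson {d : ℕ} (ν : Measure (ℝ≥0 × ℝ≥0)) [SFinite ν]
    (hν : ν {p | p.1 = 0} = 0) (ρ : Measure (Fin d → ℝ≥0)) [IsProbabilityMeasure ρ] :
    ∃ Q : Measure (PointSpace × (ℕ → Fin d → ℝ≥0)), IsProbabilityMeasure Q ∧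
      IsMarkedPoisson Q ν ρ (fun i ω => (point i ω.1).1) (fun i ω => (point i ω.1).2)
        fun i ω => ω.2 i := by
  obtain ⟨Q, hQ, hlap⟩ := exists_measure_pointSpace ν
  have hfst : MeasurePreserving Prod.fst (Q.prod (Measure.infinitePi fun _ : ℕ => ρ)) Q :=
    measurePreserving_fst
  have hsnd : MeasurePreserving Prod.snd (Q.prod (Measure.infinitePi fun _ : ℕ => ρ))
    (Measure.infinitePi fun _ : ℕ => ρ) := measurePreserving_snd
  have hW : ∀ i, Measurable fun ω => (point i ω).1 := fun i => (measurable_point i).fst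
  have hV : ∀ i, Measurable fun ω => (point i ω).2 := fun i => (measurable_point i).snd
  have hpoisson : IsPoissonRandomMeasure Q ν
      (jumpMeasure (fun i ω => (point i ω).1) fun i ω => (point i ω).2) :=
    isPoissonRandomMeasure_jumpMeasure hν hW hV fun F hF hF0 => hlap F hF (hF0 0)
  refine ⟨Q.prod (Measure.infinitePi fun _ => ρ), inferInstance, fun i => (hW i).comp measurable_fst,
    fun i => (hV i).comp measurable_fst, hpoisson.comp_measurePreserving hfst, fun i => by fun_prop,
    fun i => ?_, ?_, ?_⟩
  · have := ((measurePreserving_eval_infinitePi (fun _ : ℕ => ρ) i).comp hsnd).map_eq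
    exact this
  · exact iIndepFun_comp_measurePreserving (f := fun i (x : ℕ → Fin d → ℝ≥0) => x i)
      (fun i => by fun_prop) (iIndepFun_infinitePi (X := fun _ x => x) fun _ => by fun_prop) hsnd
  · exact (indepFun_prod (μ := Q) (ν := Measure.infinitePi fun _ : ℕ => ρ)
      (X := fun ω i => ((point i ω).1, (point i ω).2)) (Y := fun x => x)
      (measurable_pi_lambda _ fun i => (hW i).prodMk (hV i)) measurable_id).symm

end Existence

/-! ### Assembly of the two directions. -/

section Main

/-- A dense set approaches every `t` strictly from the right, so right limits identify the
functions. -/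
lemma eq_of_continuousWithinAt_of_denseRange {E : Type*} [TopologicalSpace E] [T2Space E]
    {f g : ℝ≥0 → E} (hf : ∀ t, ContinuousWithinAt f (Ici t) t)
    (hg : ∀ t, ContinuousWithinAt g (Ici t) t) {q : ℕ → ℝ≥0} (hq : DenseRange q)
    (h : ∀ n, f (q n) = g (q n)) : f = g := by
  ext t
  obtain ⟨u, -, hu, hlim⟩ := Dense.exists_seq_strictAnti_tendsto hq t
  have hlim' : Tendsto u atTop (𝓝[≥] t) :=
    tendsto_nhdsWithin_iff.2 ⟨hlim, .of_forall fun n => mem_Ici.2 (le_of_lt (mem_Ioi.1 (hu n).1))⟩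
  refine tendsto_nhds_unique ((hf t).tendsto.comp hlim') (((hg t).tendsto.comp hlim').congr ?_)
  intro n
  obtain ⟨m, hm⟩ := (hu n).2
  simp only [Function.comp_apply, ← hm, h]

variable {Ω : Type*} [MeasurableSpace Ω] {P : Measure Ω} {d : ℕ} {h : (Fin d → ℝ≥0) → ℝ≥0}
  {ν : Measure (ℝ≥0 × ℝ≥0)} {W V : ℕ → Ω → ℝ≥0} {M : ℕ → Ω → Fin d → ℝ≥0}

lemma IsSeriesRepresentation.isMarkedPoisson {Ystar : ℝ≥0 → Ω → ℝ≥0}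
    (hr : IsSeriesRepresentation P ν Ystar W V) (hs : IsScoreSequence P h W V M) :
    IsMarkedPoisson P ν (scoreLaw h) W V M :=
  ⟨hr.measurable_weight, hr.measurable_time, hr.poisson, hs.measurable, hs.law, hs.iIndep,
    hs.indep⟩

lemma IsMarkedPoisson.isScoreSequence (hm : IsMarkedPoisson P ν (scoreLaw h) W V M) :
    IsScoreSequence P h W V M :=
  ⟨hm.measurable_mark, hm.law, hm.iIndep, hm.indep⟩

lemma IsMarkedPoisson.isSeriesRepresentation [IsProbabilityMeasure P]
    {ρ : Measure (Fin d → ℝ≥0)} (hm : IsMarkedPoisson P ν ρ W V M)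
    (hν : IsUnivariateLevyIntensity ν) :
    IsSeriesRepresentation P ν (fun t ω => ∑' i, W i ω * {x | x ≤ t}.indicator 1 (V i ω)) W V := by
  have := hν.sigmaFinite
  have h1 := hm.const_mark fun _ : Fin 1 => 1
  have hlevy : IsLevyIntensity (markedIntensity ν (.dirac fun _ : Fin 1 => 1)) := by
    rw [markedIntensity_dirac_one]
    exact hν
  refine ⟨?_, hm.measurable_weight, hm.measurable_time, hm.poisson, ?_⟩
  · have := h1.isSubordinatorVector hlevy
    simp only [one_mul, markedIntensity_dirac_one] at this
    exact this
  · filter_upwards [h1.ae_summable hlevy] with ω hω t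
    simpa only [one_mul] using (hω t 0).hasSum

/-- A compound vector of subordinators is, on an extension of the probability space, a series of
scored jumps of a subordinator. -/
theorem IsCompoundVector.exists_isSeriesRepresentation {Ω : Type u} [MeasurableSpace Ω]
    {P : Measure Ω} [IsProbabilityMeasure P] {d : ℕ} {h : (Fin d → ℝ≥0) → ℝ≥0}
    {νstar : Measure (ℝ≥0 × ℝ≥0)} {Y : ℝ≥0 → Ω → Fin d → ℝ≥0}
    (hY : IsCompoundVector P h νstar Y) :
    ∃ (Ω' : Type u) (_ : MeasurableSpace Ω') (P' : Measure Ω') (_ : IsProbabilityMeasure P')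
        (π : Ω' → Ω) (_ : MeasurePreserving π P' P)
        (Ystar : ℝ≥0 → Ω' → ℝ≥0) (W V : ℕ → Ω' → ℝ≥0) (M : ℕ → Ω' → Fin d → ℝ≥0),
      IsSeriesRepresentation P' νstar Ystar W V ∧ IsScoreSequence P' h W V M ∧
      ∀ᵐ ω ∂P', ∀ (t : Fin d → ℝ≥0) (j : Fin d),
        HasSum (fun i => M i ω j * W i ω * {x | x ≤ t j}.indicator 1 (V i ω))
          (Y (t j) (π ω) j) := by
  have hsf := hY.directing.sigmaFinite
  have hprob := hY.score.isProbabilityMeasure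
  have hsub := hY.subordinator
  have hlevy := hsub.levy
  rw [compoundIntensity_eq_markedIntensity hY.score hY.directing.null_zero] at hsub hlevy
  obtain ⟨Q, hQ, hmQ⟩ := exists_isMarkedPoisson νstar hY.directing.null_zero (scoreLaw h)
  have hsubQ := hmQ.isSubordinatorVector hlevy
  set Y₂ : ℝ≥0 → PointSpace × (ℕ → Fin d → ℝ≥0) → Fin d → ℝ≥0 := fun t ω j =>
    ∑' i, ω.2 i j * (point i ω.1).1 * {x | x ≤ t}.indicator 1 (point i ω.1).2 with hY₂
  have hy₂ : Measurable fun ω n => Y₂ (TopologicalSpace.denseSeq ℝ≥0 n) ω :=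
    measurable_pi_lambda _ fun n => hsubQ.measurable _
  have hborel : StandardBorelSpace (PointSpace × (ℕ → Fin d → ℝ≥0)) := .prod
  obtain ⟨Ω', mΩ', P', hP', π, τ, hπ, hτ, hlaw⟩ := exists_extension P Q
    (measurable_pi_lambda _ fun n => hsub.measurable (TopologicalSpace.denseSeq ℝ≥0 n)) hy₂
    (hsub.map_seq_eq hsubQ (TopologicalSpace.denseSeq ℝ≥0))
  have hm := hmQ.comp_measurePreserving hτ
  refine ⟨Ω', mΩ', P', hP', π, hπ, _, _, _, _, hm.isSeriesRepresentation hY.directing,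
    hm.isScoreSequence, ?_⟩
  -- The joint law of `(y₂, ω)` under `Q` lives on the measurable graph of `y₂`; `hlaw` transports
  -- this to `P'`.
  have heq : ∀ᵐ ω ∂P', (fun n => Y (TopologicalSpace.denseSeq ℝ≥0 n) (π ω)) =
      fun n => Y₂ (TopologicalSpace.denseSeq ℝ≥0 n) (τ ω) := by
    have hmeas : Measurable fun ω => ((fun n => Y (TopologicalSpace.denseSeq ℝ≥0 n) (π ω)), τ ω) :=
      ((measurable_pi_lambda _ fun n => hsub.measurable (TopologicalSpace.denseSeq ℝ≥0 n)).comp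
        hπ.measurable).prodMk hτ.measurable
    have hset : MeasurableSet {p : (ℕ → Fin d → ℝ≥0) × (PointSpace × (ℕ → Fin d → ℝ≥0)) |
        p.1 = fun n => Y₂ (TopologicalSpace.denseSeq ℝ≥0 n) p.2} :=
      measurableSet_eq_fun measurable_fst (hy₂.comp measurable_snd)
    have hae : ∀ᵐ p ∂(Q.map fun ω => ((fun n => Y₂ (TopologicalSpace.denseSeq ℝ≥0 n) ω), ω)),
        p.1 = fun n => Y₂ (TopologicalSpace.denseSeq ℝ≥0 n) p.2 :=
      (ae_map_iff (hy₂.prodMk measurable_id).aemeasurable hset).2 (.of_forall fun _ => rfl)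
    rw [← hlaw] at hae
    exact (ae_map_iff hmeas.aemeasurable hset).1 hae
  filter_upwards [heq, hπ.quasiMeasurePreserving.ae hsub.right_continuous,
    hτ.quasiMeasurePreserving.ae hsubQ.right_continuous, hm.ae_summable hlevy]
    with ω h1 h2 h3 h4 t j
  have e := eq_of_continuousWithinAt_of_denseRange h2 h3 (TopologicalSpace.denseRange_denseSeq ℝ≥0)
    fun n => congrFun h1 n
  have e' : Y (t j) (π ω) j = Y₂ (t j) (τ ω) j := congrFun (congrFun e (t j)) j
  rw [e']
  exact (h4 (t j) j).hasSum

/-- A series of scored jumps of a subordinator is a compound vector of subordinators. -/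
theorem IsSeriesRepresentation.isCompoundVector [IsProbabilityMeasure P] {Ystar : ℝ≥0 → Ω → ℝ≥0}
    (hr : IsSeriesRepresentation P ν Ystar W V) (hs : IsScoreSequence P h W V M)
    (hh : IsScoreDensity h) (hν : IsUnivariateLevyIntensity ν)
    (hlevy : IsLevyIntensity (compoundIntensity h ν)) :
    (∀ᵐ ω ∂P, ∀ (t : ℝ≥0) (j : Fin d),
      Summable fun i => M i ω j * W i ω * {x | x ≤ t}.indicator 1 (V i ω)) ∧
    IsCompoundVector P h ν fun t ω j =>
      ∑' i, M i ω j * W i ω * {x | x ≤ t}.indicator 1 (V i ω) := by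
  have hprob := hh.isProbabilityMeasure
  have hint := compoundIntensity_eq_markedIntensity hh hν.null_zero
  have hm := hr.isMarkedPoisson hs
  rw [hint] at hlevy
  refine ⟨hm.ae_summable hlevy, hh, hν, ?_⟩
  rw [hint]
  exact hm.isSubordinatorVector hlevy

end Main

end CompoundSubordinator

/-- Let `Y` be a compound vector of subordinators with score distribution `h` and directing Lévy
measure `νstar`.

(1) On an extension `π : Ω' → Ω` of the probability space there are a subordinator `Ystar` with Lévy
intensity `νstar`, a series representation `∑ i, W_i 1{V_i ≤ t}` of it, and i.i.d. vectors `M_i` with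
law `h`, independent of it, such that almost surely `Y_j(t_j) = ∑ i, M_{j,i} W_i 1{V_i ≤ t_j}` for
all `t` and `j`.

(2) Conversely, for every series representation of a subordinator with Lévy intensity `νstar` and
every such sequence `M_i`, the series almost surely converge for all `t` and `j`, and they define a
compound vector of subordinators with score distribution `h` and directing Lévy measure `νstar`. -/
theorem mainTheorem3 {Ω : Type u} [MeasurableSpace Ω] (P : Measure Ω) [IsProbabilityMeasure P]
    {d : ℕ} (h : (Fin d → ℝ≥0) → ℝ≥0) (νstar : Measure (ℝ≥0 × ℝ≥0))
    (Y : ℝ≥0 → Ω → Fin d → ℝ≥0)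
    (hY : CompoundSubordinator.IsCompoundVector P h νstar Y) :
    (∃ (Ω' : Type u) (_ : MeasurableSpace Ω') (P' : Measure Ω') (_ : IsProbabilityMeasure P')
        (π : Ω' → Ω) (_ : MeasurePreserving π P' P)
        (Ystar : ℝ≥0 → Ω' → ℝ≥0) (W V : ℕ → Ω' → ℝ≥0) (M : ℕ → Ω' → Fin d → ℝ≥0),
      CompoundSubordinator.IsSeriesRepresentation P' νstar Ystar W V ∧
      CompoundSubordinator.IsScoreSequence P' h W V M ∧
      ∀ᵐ ω ∂P', ∀ (t : Fin d → ℝ≥0) (j : Fin d),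
        HasSum (fun i => M i ω j * W i ω * {x | x ≤ t j}.indicator 1 (V i ω))
          (Y (t j) (π ω) j)) ∧
    (∀ (Ω' : Type v) [MeasurableSpace Ω'] (P' : Measure Ω') [IsProbabilityMeasure P']
        (Ystar : ℝ≥0 → Ω' → ℝ≥0) (W V : ℕ → Ω' → ℝ≥0) (M : ℕ → Ω' → Fin d → ℝ≥0),
      CompoundSubordinator.IsSeriesRepresentation P' νstar Ystar W V →
      CompoundSubordinator.IsScoreSequence P' h W V M →
      (∀ᵐ ω ∂P', ∀ (t : ℝ≥0) (j : Fin d),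
        Summable fun i => M i ω j * W i ω * {x | x ≤ t}.indicator 1 (V i ω)) ∧
      CompoundSubordinator.IsCompoundVector P' h νstar fun t ω j =>
        ∑' i, M i ω j * W i ω * {x | x ≤ t}.indicator 1 (V i ω)) := by
  -- From `Y` the converse takes only facts about `h`, `νstar` and the compound intensity, so its
  -- probability space is arbitrary.
  exact ⟨hY.exists_isSeriesRepresentation, fun Ω' _ P' _ Ystar W V M hr hs =>
    hr.isCompoundVector hs hY.score hY.directing hY.subordinator.levy⟩
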